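/- **Setting.** A hybrid system $\mathcal H=\{C,F,D,G\}$ ($x\in C,\ \dot x\in F(x)$; $x\in D,\ x^+\in G(x)$) has solutions $x(t,j)$ defined on hybrid time domains. A function $\beta:\mathbb R_{\ge0}^2\to\mathbb R_{\ge0}$ is of class $\mathcal{KL}$ if it is nondecreasing in its first argument, nonincreasing in its second, $\lim_{r\to0^+}\beta(r,s)=0$ for each $s$, and $\lim_{s\to\infty}\beta(r,s)=0$ for each $r$. A compact set $\mathcal A$ is UGAS for $\mathcal H$ if there is $\beta\in\mathcal{KL}$ with $|x(t,j)|_{\mathcal A}\le\beta(|x(0,0)|_{\mathcal A},t+j)$ for every maximal solution $x$ and all $(t,j)\in\operatorname{dom}x$. It is SGPAS as $\delta\to0^+$ for a family $\mathcal H_\delta$ if there is $\beta\in\mathcal{KL}$ such that for all $\Delta>\nu>0$ there is $\varepsilon^*>0$ such that for all $\delta\in(0,\varepsilon^*)$ every maximal solution of $\mathcal H_\delta$ with $|x(0,0)|\le\Delta$ satisfies $|x(t,j)|_{\mathcal A}\le\beta(|x(0,0)|_{\mathcal A},t+j)+\nu$ for all $(t,j)\in\operatorname{dom}x$. Outer semicontinuity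 (OSC) and local boundedness (LB) of a set-valued map relative to a set $K$ mean OSC and LB, at each point of $K$, of the map that equals the given one on $K$ and is empty off $K$. Consider decision-making dynamics with state $x=(\hat u,\hat z)\in\mathbb R^n\times\mathbb R^r$ and input $\xi\in\mathbb R^n$: $\dot x\in\hat F_\delta(x,\xi)$ for $x\in C$, and $x^+\in\hat G_\delta(x)$ for $x\in D$. Given $\hat{\mathbb U}\subset\mathbb R^n$, a response map $J$ and a set $\mathcal A$, *Assumption 1* says: (a) there is $\delta^*>0$ such that for all $\delta\in(0,\delta^*]$: $C$ and $D$ are closed and their $\hat u$-projections lie in $\hat{\mathbb U}$; $\hat F_\delta$ is OSC, LB and convex-valued relative to $C\times\mathbb R^n$; $\hat G_\delta$ is OSC and LB relative to $D$; (b) $\mathcal A$ is compact and is SGPAS as $\delta\to0^+$ for the target system obtained by substituting $\xi=\nabla J(\hat u)$. **Proposition (Seeking under slowly varying parameters).** Let $\mathcal Q\subset\mathbb R^m$ be compact and $\hat{\mathbb U}\subset\mathbb R^n$. For each $q\in\mathcal Q$ let $J_q:\mathbb R^n\to\mathbb R$ (possibly independent of $q$) be differentiable at every point of $\hat{\mathbb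 U}$, with $(q,u)\mapsto\nabla J_q(u)$ continuous on $\mathcal Q\times\hat{\mathbb U}$. Let $f(\hat u,\xi,q)\subset\mathbb R^n$ be a set-valued map such that the dynamics $\dot{\hat u}\in f(\hat u,\xi,q),\ \dot q=0,\ \hat u^+=\hat u,\ q^+\in\mathcal Q$, with flow and jump sets $\hat{\mathbb U}\times\mathcal Q$, satisfy item (a). For each $q\in\mathcal Q$ let $\mathcal O_q\subset\hat{\mathbb U}$ be nonempty, suppose that $\mathcal O:=\{(\hat u,q):q\in\mathcal Q,\ \hat u\in\mathcal O_q\}$ is compact, and suppose that for each fixed $q\in\mathcal Q$ the set $\mathcal O_q$ is compact and UGAS for $\dot{\hat u}\in f(\hat u,\nabla J_q(\hat u),q)$, $\hat u\in\hat{\mathbb U}$. Let $\eta_1>0$ and $N_0\ge1$. For $\eta_3>0$ consider the hybrid system with $\hat z=(q,\tau_1)$ and $$\dot{\hat u}\in f(\hat u,\xi,q),\quad \dot q\in\eta_3\mathbb B,\quad \dot\tau_1\in[0,\eta_1],\qquad (\hat u,q,\tau_1)\in C=\hat{\mathbb U}\times\mathcal Q\times[0,N_0],$$ $$\hat u^+=\hat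 u,\quad q^+\in q+\eta_3\mathbb B,\quad \tau_1^+=\tau_1-1,\qquad (\hat u,q,\tau_1)\in D=\hat{\mathbb U}\times\mathcal Q\times[1,N_0].$$ Then this system satisfies items (a) and (b) of Assumption 1 with $\delta=\eta_3$, response map $J_q$, $\Psi:=\mathcal Q\times[0,N_0]$ (which is compact) and $\mathcal A:=\{(\hat u,q,\tau_1):(\hat u,q)\in\mathcal O,\ (q,\tau_1)\in\Psi\}$. -/

import Mathlib

open Set Filter Topology MeasureTheory

/-! ## Regularity of set-valued maps -/

/-- Outer semicontinuity of `M` relative to `K`: the map equal to `M` on `K` and empty off `K` is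
outer semicontinuous at every point of `K`. -/
def OSCRel {X Y : Type*} [TopologicalSpace X] [TopologicalSpace Y] (M : X → Set Y) (K : Set X) :
    Prop :=
  ∀ z ∈ K, ∀ (zs : ℕ → X) (ss : ℕ → Y) (s : Y), (∀ i, zs i ∈ K) → (∀ i, ss i ∈ M (zs i)) →
    Tendsto zs atTop (𝓝 z) → Tendsto ss atTop (𝓝 s) → s ∈ M z

/-- Local boundedness of `M` relative to `K`: the map equal to `M` on `K` and empty off `K` is
locally bounded at every point of `K`. -/
def LBRel {X Y : Type*} [TopologicalSpace X] [PseudoMetricSpace Y] (M : X → Set Y) (K : Set X) :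
    Prop :=
  ∀ z ∈ K, ∃ N : Set X, IsOpen N ∧ z ∈ N ∧ Bornology.IsBounded (⋃ w ∈ N ∩ K, M w)

/-! ## Hybrid time domains, hybrid arcs, hybrid systems and their solutions -/

/-- Compact hybrid time domains: finite unions of `[t j, t (j+1)] × {j}`, `j = 0, …, k`, with
`0 = t 0 ≤ t 1 ≤ …`. -/
def IsCompactHybridTimeDomain (E : Set (ℝ × ℕ)) : Prop :=
  ∃ (k : ℕ) (t : ℕ → ℝ), t 0 = 0 ∧ Monotone t ∧
    E = {p | p.2 ≤ k ∧ t p.2 ≤ p.1 ∧ p.1 ≤ t (p.2 + 1)}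

/-- Hybrid time domains: unions of nondecreasing sequences of compact hybrid time domains. -/
def IsHybridTimeDomain (E : Set (ℝ × ℕ)) : Prop :=
  ∃ e : ℕ → Set (ℝ × ℕ), Monotone e ∧ (∀ i, IsCompactHybridTimeDomain (e i)) ∧ E = ⋃ i, e i

/-- A hybrid arc. Only the values of `val` on `dom` are meaningful. -/
structure HybridArc (X : Type*) [PseudoMetricSpace X] where
  dom : Set (ℝ × ℕ)
  val : ℝ → ℕ → X
  isHybridTimeDomain : IsHybridTimeDomain dom
  locallyAC : ∀ (j : ℕ) (a b : ℝ), a < b → (∀ t ∈ Icc a b, (t, j) ∈ dom) →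
    AbsolutelyContinuousOnInterval (fun t => val t j) a b

/-- The data `(C, F, D, G)` of the hybrid inclusion `x ∈ C, ẋ ∈ F x`; `x ∈ D, x⁺ ∈ G x`. -/
structure HybridSystem (X : Type*) where
  C : Set X
  F : X → Set X
  D : Set X
  G : X → Set X

namespace HybridSystem

variable {X : Type*} [NormedAddCommGroup X] [NormedSpace ℝ X]

/-- Solutions of a hybrid system. -/
structure IsSolution (H : HybridSystem X) (x : HybridArc X) : Prop where
  init : x.val 0 0 ∈ H.C ∪ H.D
  flow : ∀ j : ℕ, ∀ᵐ t : ℝ, (t, j) ∈ x.dom →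
    x.val t j ∈ H.C ∧ ∃ v ∈ H.F (x.val t j), HasDerivAt (fun s => x.val s j) v t
  jump : ∀ (t : ℝ) (j : ℕ), (t, j) ∈ x.dom → (t, j + 1) ∈ x.dom →
    x.val t j ∈ H.D ∧ x.val t (j + 1) ∈ H.G (x.val t j)

/-- Maximal solutions: those which no solution extends to a larger domain. -/
def IsMaximalSolution (H : HybridSystem X) (x : HybridArc X) : Prop :=
  H.IsSolution x ∧ ¬ ∃ y : HybridArc X, H.IsSolution y ∧ x.dom ⊂ y.dom ∧
    ∀ p ∈ x.dom, x.val p.1 p.2 = y.val p.1 p.2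

end HybridSystem

/-! ## Stability notions -/

/-- Class `𝒦ℒ` functions `ℝ≥0 × ℝ≥0 → ℝ≥0` (the values at negative arguments are irrelevant). -/
structure IsClassKL (β : ℝ → ℝ → ℝ) : Prop where
  nonneg : ∀ r s, 0 ≤ r → 0 ≤ s → 0 ≤ β r s
  mono : ∀ s, 0 ≤ s → MonotoneOn (fun r => β r s) (Ici 0)
  anti : ∀ r, 0 ≤ r → AntitoneOn (fun s => β r s) (Ici 0)
  tendsto_fst : ∀ s, 0 ≤ s → Tendsto (fun r => β r s) (𝓝[>] 0) (𝓝 0)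
  tendsto_snd : ∀ r, 0 ≤ r → Tendsto (fun s => β r s) atTop (𝓝 0)

/-- The compact set `A` is uniformly globally asymptotically stable for `H`. -/
def UGAS {X : Type*} [NormedAddCommGroup X] [NormedSpace ℝ X] (H : HybridSystem X) (A : Set X) :
    Prop :=
  IsCompact A ∧ ∃ β : ℝ → ℝ → ℝ, IsClassKL β ∧
    ∀ x : HybridArc X, H.IsMaximalSolution x → ∀ (t : ℝ) (j : ℕ), (t, j) ∈ x.dom →
      Metric.infDist (x.val t j) A ≤ β (Metric.infDist (x.val 0 0) A) (t + j)

/-- The compact set `A` is semi-globally practically asymptotically stable, as `ε → 0⁺`, for the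
family of hybrid systems `H ε`. -/
def SGPAS {X : Type*} [NormedAddCommGroup X] [NormedSpace ℝ X] (H : ℝ → HybridSystem X)
    (A : Set X) : Prop :=
  IsCompact A ∧ ∃ β : ℝ → ℝ → ℝ, IsClassKL β ∧
    ∀ Δ ν : ℝ, 0 < ν → ν < Δ → ∃ ε' > 0, ∀ ε ∈ Ioo 0 ε',
      ∀ x : HybridArc X, (H ε).IsMaximalSolution x → ‖x.val 0 0‖ ≤ Δ →
        ∀ (t : ℝ) (j : ℕ), (t, j) ∈ x.dom →
          Metric.infDist (x.val t j) A ≤ β (Metric.infDist (x.val 0 0) A) (t + j) + ν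

/-! ## Hybrid decision-making dynamics -/

/-- `ℝⁿ` with the Euclidean norm. -/
abbrev Euc (n : ℕ) : Type := EuclideanSpace ℝ (Fin n)

/-- The product of two Euclidean spaces, with the Euclidean norm. -/
abbrev EProd (X Y : Type*) : Type _ := WithLp 2 (X × Y)

/-- Hybrid decision-making dynamics with state `x = (û, ẑ) ∈ ℝⁿ × Z`, input `ξ ∈ ℝⁿ` and tunable
parameter `δ`: `x ∈ C, ẋ ∈ F δ x ξ`; `x ∈ D, x⁺ ∈ G δ x`. -/
structure DecisionDynamics (n : ℕ) (Z : Type*) where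
  C : Set (EProd (Euc n) Z)
  F : ℝ → EProd (Euc n) Z → Euc n → Set (EProd (Euc n) Z)
  D : Set (EProd (Euc n) Z)
  G : ℝ → EProd (Euc n) Z → Set (EProd (Euc n) Z)

namespace DecisionDynamics

variable {n : ℕ} {Z : Type*} [NormedAddCommGroup Z] [InnerProductSpace ℝ Z]

/-- Item (a) of the standing assumption: regularity of the data, for all small `δ > 0`. -/
def RegularData (H : DecisionDynamics n Z) (U : Set (Euc n)) : Prop :=
  ∃ δ' > 0, ∀ δ ∈ Ioc 0 δ',
    (IsClosed H.C ∧ IsClosed H.D ∧ WithLp.fst '' H.C ⊆ U ∧ WithLp.fst '' H.D ⊆ U) ∧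
    (OSCRel (fun p : EProd (Euc n) Z × Euc n => H.F δ p.1 p.2) (H.C ×ˢ univ) ∧
      LBRel (fun p : EProd (Euc n) Z × Euc n => H.F δ p.1 p.2) (H.C ×ˢ univ) ∧
      (∀ x ∈ H.C, ∀ ξ : Euc n, Convex ℝ (H.F δ x ξ)) ∧
      OSCRel (H.G δ) H.D ∧ LBRel (H.G δ) H.D)

/-- The target hybrid system: the input `ξ` is replaced by the gradient at `û` of the response map.
The response map `J ẑ : ℝⁿ → ℝ` is allowed to depend on the auxiliary state; a fixed response map
is the case of a constant function `J`. -/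
noncomputable def target (H : DecisionDynamics n Z) (J : Z → Euc n → ℝ) (δ : ℝ) :
    HybridSystem (EProd (Euc n) Z) where
  C := H.C
  F := fun x => H.F δ x (gradient (J x.snd) x.fst)
  D := H.D
  G := H.G δ

/-- The standing assumption on decision-making dynamics: item (a), and item (b), practical
stability of the target system with respect to `{(û, ẑ) : ẑ ∈ Ψ, û ∈ O ẑ}`, with `Ψ` compact.
When `O` does not depend on `ẑ` this set is `O × Ψ`. -/
def KeyAssumption (H : DecisionDynamics n Z) (U : Set (Euc n)) (J : Z → Euc n → ℝ)
    (O : Z → Set (Euc n)) (Ψ : Set Z) : Prop :=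
  H.RegularData U ∧
    (IsCompact Ψ ∧ SGPAS (H.target J) {x | x.snd ∈ Ψ ∧ x.fst ∈ O x.snd})

end DecisionDynamics

/-! ## The systems under study -/

section Systems

variable {n m : ℕ}

/-- Decision-making dynamics switching freely in `Q`:
`û' ∈ f(û, ξ, q), q' = 0` and `û⁺ = û, q⁺ ∈ Q`, with flow and jump sets `U × Q`. -/
def freeSwitching (U : Set (Euc n)) (Q : Set (Euc m)) (f : Euc n → Euc n → Euc m → Set (Euc n)) :
    DecisionDynamics n (Euc m) where
  C := {x | x.fst ∈ U ∧ x.snd ∈ Q}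
  F := fun _ x ξ => {v | v.fst ∈ f x.fst ξ x.snd ∧ v.snd = 0}
  D := {x | x.fst ∈ U ∧ x.snd ∈ Q}
  G := fun _ x => {y | y.fst = x.fst ∧ y.snd ∈ Q}

/-- The dynamics `û' ∈ f(û, ∇J(û), q)`, `û ∈ U`, for a frozen parameter `q`, without jumps. -/
noncomputable def frozenSystem (U : Set (Euc n)) (J : Euc m → Euc n → ℝ)
    (f : Euc n → Euc n → Euc m → Set (Euc n)) (q : Euc m) : HybridSystem (Euc n) where
  C := U
  F := fun u => f u (gradient (J q) u) q
  D := ∅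
  G := fun _ => ∅

/-- Decision-making dynamics with a slowly varying, weakly jumping parameter `q` and a dwell-time
automaton `τ`; the state is `(û, (q, τ))` and the tunable parameter is `η₃`. Flows:
`û' ∈ f(û, ξ, q), q' ∈ η₃ 𝔹, τ' ∈ [0, η₁]` on `U × Q × [0, N₀]`. Jumps:
`û⁺ = û, q⁺ ∈ q + η₃ 𝔹, τ⁺ = τ - 1` on `U × Q × [1, N₀]`. -/
def slowlyVarying (U : Set (Euc n)) (Q : Set (Euc m)) (f : Euc n → Euc n → Euc m → Set (Euc n))
    (η₁ N₀ : ℝ) : DecisionDynamics n (EProd (Euc m) ℝ) where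
  C := {x | x.fst ∈ U ∧ x.snd.fst ∈ Q ∧ x.snd.snd ∈ Icc 0 N₀}
  F := fun η₃ x ξ => {v | v.fst ∈ f x.fst ξ x.snd.fst ∧
    v.snd.fst ∈ Metric.closedBall 0 η₃ ∧ v.snd.snd ∈ Icc 0 η₁}
  D := {x | x.fst ∈ U ∧ x.snd.fst ∈ Q ∧ x.snd.snd ∈ Icc 1 N₀}
  G := fun η₃ x => {y | y.fst = x.fst ∧
    y.snd.fst ∈ Metric.closedBall x.snd.fst η₃ ∧ y.snd.snd = x.snd.snd - 1}

end Systems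

/-! The proof compares the slowly varying system with its frozen systems by a compactness argument.
Since `û` never jumps, its values along a hybrid solution form a curve in ordinary time. The timer
grows at rate at most `η₁`, loses one unit per jump and stays in `[0, N₀]`, so the number of jumps
is at most affine in the elapsed time. Hence `q` moves by at most a multiple of `η₃ * (1 + |s - t|)`
between times `s` and `t`. This is the content of `SlowTrajectory` and `exists_slowTrajectory`.

As `η₃ → 0`, limits of bounded trajectories over bounded time windows solve the inclusion with one
frozen parameter (`SlowTrajectory.exists_limit`). The frozen `𝒦ℒ` bound is applied only at that
limit parameter, so no uniformity of the bounds in `q` is needed.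

Two contradiction arguments use these limits. For stability, look at the moment of exit from a
neighbourhood of the target: if it stays bounded, the limit starts in `O q` and cannot leave it; if
it is unbounded, the limit over a window of length `N` just before the exit ends within `β r N` of
`O q`, where `r` does not depend on `N`, and `N` is arbitrary. For attractivity, the frozen bound
brings the trajectory close to the target at a fixed time, after which stability keeps it there.

Finally, `exists_isClassKL_of_practical` assembles the two practical properties into a single `𝒦ℒ`
function. Large `t + j` forces large `t` because jumps are bounded in terms of time. -/

/-! ### Absolutely continuous curves -/

theorem AbsolutelyContinuousOnInterval.lipschitz_comp {X Y : Type*} [PseudoMetricSpace X]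
    [PseudoMetricSpace Y] {f : ℝ → X} {a b : ℝ} {φ : X → Y} {K : NNReal} (hφ : LipschitzWith K φ)
    (hf : AbsolutelyContinuousOnInterval f a b) :
    AbsolutelyContinuousOnInterval (fun t => φ (f t)) a b := by
  have h : Tendsto (fun E : ℕ × (ℕ → ℝ × ℝ) =>
      (K : ℝ) * ∑ i ∈ Finset.range E.1, dist (f (E.2 i).1) (f (E.2 i).2))
      (AbsolutelyContinuousOnInterval.totalLengthFilter ⊓
        𝓟 (AbsolutelyContinuousOnInterval.disjWithin a b)) (𝓝 0) := by
    simpa using Tendsto.const_mul (K : ℝ) hf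
  refine squeeze_zero (fun E => Finset.sum_nonneg fun i _ => dist_nonneg) (fun E => ?_) h
  rw [Finset.mul_sum]
  exact Finset.sum_le_sum fun i _ => hφ.dist_le_mul _ _

theorem AbsolutelyContinuousOnInterval.congr {X : Type*} [PseudoMetricSpace X] {f g : ℝ → X}
    {a b : ℝ} (hf : AbsolutelyContinuousOnInterval f a b) (h : EqOn f g (uIcc a b)) :
    AbsolutelyContinuousOnInterval g a b := by
  refine Tendsto.congr' ?_ hf
  filter_upwards [mem_inf_of_right (mem_principal_self _)] with E hE
  refine Finset.sum_congr rfl fun i hi => ?_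
  rw [h (hE.1 i hi).1, h (hE.1 i hi).2]

theorem AbsolutelyContinuousOnInterval.sub_le_of_ae_hasDerivAt {g : ℝ → ℝ} {a b c : ℝ}
    (hab : a ≤ b) (hg : AbsolutelyContinuousOnInterval g a b)
    (h : ∀ᵐ t : ℝ, t ∈ Ioo a b → ∃ v ≤ c, HasDerivAt g v t) : g b - g a ≤ c * (b - a) := by
  rw [← hg.integral_deriv_eq_sub]
  calc ∫ x in a..b, deriv g x ≤ ∫ _ in a..b, c := by
        refine intervalIntegral.integral_mono_ae_restrict hab hg.intervalIntegrable_deriv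
          intervalIntegrable_const ?_
        have hb : ∀ᵐ t : ℝ, t ≠ b := by simp [ae_iff, measure_singleton]
        have ha : ∀ᵐ t : ℝ, t ≠ a := by simp [ae_iff, measure_singleton]
        refine (ae_restrict_iff' measurableSet_Icc).2 ?_
        filter_upwards [h, ha, hb] with t ht hta htb htI
        obtain ⟨v, hv, hd⟩ := ht ⟨lt_of_le_of_ne htI.1 hta.symm, lt_of_le_of_ne htI.2 htb⟩
        rw [hd.deriv]
        exact hv
    _ = c * (b - a) := by simp [mul_comm]

/-! ### Hybrid time domains -/

namespace IsHybridTimeDomain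

variable {E : Set (ℝ × ℕ)}

/-- Two points of the domain lie in a common compact subdomain, so every question about their order
reduces to arithmetic with one monotone sequence of jump times. -/
theorem exists_times (hE : IsHybridTimeDomain E) {s t : ℝ} {i j : ℕ} (hs : (s, i) ∈ E)
    (ht : (t, j) ∈ E) : ∃ (k : ℕ) (τ : ℕ → ℝ), τ 0 = 0 ∧ Monotone τ ∧
      (∀ r n, n ≤ k → τ n ≤ r → r ≤ τ (n + 1) → (r, n) ∈ E) ∧
      (i ≤ k ∧ τ i ≤ s ∧ s ≤ τ (i + 1)) ∧ (j ≤ k ∧ τ j ≤ t ∧ t ≤ τ (j + 1)) := by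
  obtain ⟨e, he, hc, rfl⟩ := hE
  obtain ⟨a, ha⟩ := mem_iUnion.1 hs
  obtain ⟨b, hb⟩ := mem_iUnion.1 ht
  obtain ⟨k, τ, h0, hm, hτ⟩ := hc (max a b)
  have ha' := he (le_max_left a b) ha
  have hb' := he (le_max_right a b) hb
  rw [hτ] at ha' hb'
  refine ⟨k, τ, h0, hm, fun r n hn h1 h2 => mem_iUnion.2 ⟨max a b, ?_⟩, ha', hb'⟩
  rw [hτ]
  exact ⟨hn, h1, h2⟩

theorem time_nonneg (hE : IsHybridTimeDomain E) {t : ℝ} {j : ℕ} (h : (t, j) ∈ E) : 0 ≤ t := by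
  obtain ⟨k, τ, h0, hm, -, -, hj⟩ := hE.exists_times h h
  exact h0 ▸ (hm (Nat.zero_le j)).trans hj.2.1

theorem zero_mem (hE : IsHybridTimeDomain E) : ((0 : ℝ), 0) ∈ E := by
  obtain ⟨e, -, he, rfl⟩ := hE
  obtain ⟨k, τ, h0, hm, hτ⟩ := he 0
  refine mem_iUnion.2 ⟨0, ?_⟩
  rw [hτ]
  exact ⟨Nat.zero_le k, h0.le, h0 ▸ hm (Nat.zero_le 1)⟩

theorem exists_level (hE : IsHybridTimeDomain E) {s t : ℝ} {j : ℕ} (h : (t, j) ∈ E)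
    (hs : 0 ≤ s) (hst : s ≤ t) : ∃ i ≤ j, (s, i) ∈ E := by
  obtain ⟨k, τ, h0, hm, hτ, -, hj⟩ := hE.exists_times h h
  have key : ∀ j, s ≤ τ (j + 1) → ∃ i ≤ j, τ i ≤ s ∧ s ≤ τ (i + 1) := by
    intro j
    induction j with
    | zero => exact fun h1 => ⟨0, le_rfl, h0 ▸ hs, h1⟩
    | succ j ih =>
      intro h1
      rcases le_total (τ (j + 1)) s with h2 | h2
      · exact ⟨j + 1, le_rfl, h2, h1⟩
      · obtain ⟨i, hi, h3⟩ := ih h2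
        exact ⟨i, hi.trans j.le_succ, h3⟩
  obtain ⟨i, hi, h1, h2⟩ := key j (hst.trans hj.2.2)
  exact ⟨i, hi, hτ _ _ (hi.trans hj.1) h1 h2⟩

theorem level_le (hE : IsHybridTimeDomain E) {s t : ℝ} {i j : ℕ} (hs : (s, i) ∈ E)
    (ht : (t, j) ∈ E) (hst : s < t) : i ≤ j := by
  obtain ⟨k, τ, h0, hm, hτ, hi, hj⟩ := hE.exists_times hs ht
  by_contra! hji
  exact absurd ((hj.2.2.trans (hm hji)).trans hi.2.1) (not_le.2 hst)

theorem mem_of_mem_Icc (hE : IsHybridTimeDomain E) {s r t : ℝ} {i : ℕ} (hs : (s, i) ∈ E)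
    (ht : (t, i) ∈ E) (hr : r ∈ Icc s t) : (r, i) ∈ E := by
  obtain ⟨k, τ, h0, hm, hτ, hi, hj⟩ := hE.exists_times hs ht
  exact hτ _ _ hi.1 (hi.2.1.trans hr.1) (hr.2.trans hj.2.2)

theorem exists_jump (hE : IsHybridTimeDomain E) {s t : ℝ} {i j : ℕ} (hs : (s, i) ∈ E)
    (ht : (t, j) ∈ E) (hij : i < j) :
    ∃ r, s ≤ r ∧ r ≤ t ∧ (r, i) ∈ E ∧ (r, i + 1) ∈ E := by
  obtain ⟨k, τ, h0, hm, hτ, hi, hj⟩ := hE.exists_times hs ht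
  exact ⟨τ (i + 1), hi.2.2, (hm hij).trans hj.2.1, hτ _ _ hi.1 (hm i.le_succ) le_rfl,
    hτ _ _ (Nat.succ_le_of_lt hij |>.trans hj.1) le_rfl (hm (i + 1).le_succ)⟩

/-- Flow conditions say nothing on a slice reduced to a point. This separates the points with some
flow behind them from the initial point and from those reached by a jump. -/
theorem level_eq_zero_or_exists (hE : IsHybridTimeDomain E) {t : ℝ} {j : ℕ} (ht : (t, j) ∈ E) :
    (∃ s < t, (s, j) ∈ E) ∨ (t = 0 ∧ j = 0) ∨ ∃ i, j = i + 1 ∧ (t, i) ∈ E := by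
  obtain ⟨k, τ, h0, hm, hτ, -, hj⟩ := hE.exists_times ht ht
  rcases hj.2.1.lt_or_eq with h | h
  · exact Or.inl ⟨τ j, h, hτ _ _ hj.1 le_rfl (hm j.le_succ)⟩
  · right
    rcases j with _ | i
    · exact Or.inl ⟨by rw [← h, h0], rfl⟩
    · exact Or.inr ⟨i, rfl, hτ _ _ (i.le_succ.trans hj.1) (h ▸ hm i.le_succ) h.symm.le⟩

/-- Growth along a hybrid time domain: a bound for the growth along flows and a bound for the
growth across jumps add up. -/
theorem sub_le (hE : IsHybridTimeDomain E) (V : ℝ → ℕ → ℝ) {a b s t : ℝ} {i j : ℕ}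
    (hflow : ∀ n s' t', s ≤ s' → s' ≤ t' → t' ≤ t → (s', n) ∈ E → (t', n) ∈ E →
      V t' n - V s' n ≤ a * (t' - s'))
    (hjump : ∀ r n, s ≤ r → r ≤ t → (r, n) ∈ E → (r, n + 1) ∈ E → V r (n + 1) - V r n ≤ b)
    (hs : (s, i) ∈ E) (ht : (t, j) ∈ E) (hst : s ≤ t) (hij : i ≤ j) :
    V t j - V s i ≤ a * (t - s) + b * (j - i) := by
  obtain ⟨d, rfl⟩ := Nat.exists_eq_add_of_le hij
  induction d generalizing s i with
  | zero => simpa using hflow i s t le_rfl hst le_rfl hs ht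
  | succ d ih =>
    obtain ⟨r, h1, h2, h3, h4⟩ := hE.exists_jump hs ht (by omega)
    have e1 := hflow i s r le_rfl h1 h2 hs h3
    have e2 := hjump r i h1 h2 h3 h4
    have e3 := ih (s := r) (i := i + 1)
      (fun n s' t' h h' => hflow n s' t' (h1.trans h) h')
      (fun r' n h => hjump r' n (h1.trans h)) h4 h2
      (by rwa [show i + 1 + d = i + (d + 1) by omega]) (by omega)
    rw [show i + 1 + d = i + (d + 1) by omega] at e3
    push_cast at e3 ⊢
    nlinarith

end IsHybridTimeDomain

/-! ### Flow estimates for solutions -/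

theorem HybridArc.absolutelyContinuous {X : Type*} [PseudoMetricSpace X] (x : HybridArc X)
    {s t : ℝ} {i : ℕ} (hs : (s, i) ∈ x.dom) (ht : (t, i) ∈ x.dom) (hst : s < t) :
    AbsolutelyContinuousOnInterval (fun r => x.val r i) s t :=
  x.locallyAC i s t hst fun _ hr => x.isHybridTimeDomain.mem_of_mem_Icc hs ht hr

namespace HybridSystem.IsSolution

variable {X : Type*} [NormedAddCommGroup X] [NormedSpace ℝ X] {H : HybridSystem X}
  {x : HybridArc X}

/-- Testing against a linear functional turns the differential inclusion into a scalar derivative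
bound; no velocity selection has to be integrated. -/
theorem flow_sub_le (hx : H.IsSolution x) (ℓ : X →L[ℝ] ℝ) {c s t : ℝ} {i : ℕ}
    (hs : (s, i) ∈ x.dom) (ht : (t, i) ∈ x.dom) (hst : s ≤ t)
    (h : ∀ r ∈ Ioo s t, x.val r i ∈ H.C → ∀ v ∈ H.F (x.val r i), ℓ v ≤ c) :
    ℓ (x.val t i) - ℓ (x.val s i) ≤ c * (t - s) := by
  rcases hst.eq_or_lt with rfl | hst'
  · simp
  refine ((x.absolutelyContinuous hs ht hst').lipschitz_comp
    ℓ.lipschitz).sub_le_of_ae_hasDerivAt hst ?_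
  filter_upwards [hx.flow i] with r hr hrI
  obtain ⟨h1, v, hv, hd⟩ :=
    hr (x.isHybridTimeDomain.mem_of_mem_Icc hs ht (Ioo_subset_Icc_self hrI))
  exact ⟨ℓ v, h r hrI h1 v hv, ℓ.hasFDerivAt.comp_hasDerivAt r hd⟩

/-- The flow condition holds almost everywhere, hence on a dense set of times; continuity and
closedness of `C` extend it to every time, endpoints included. -/
theorem mem_flowSet (hx : H.IsSolution x) (hC : IsClosed H.C) {s r t : ℝ} {i : ℕ}
    (hs : (s, i) ∈ x.dom) (ht : (t, i) ∈ x.dom) (hst : s < t) (hr : r ∈ Icc s t) :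
    x.val r i ∈ H.C := by
  have hcont := (x.absolutelyContinuous hs ht hst).continuousOn
  rw [uIcc_of_le hst.le] at hcont
  have hd := Measure.dense_of_ae (hx.flow i)
  have hcl : Icc s t ⊆ closure (Ioo s t ∩ {t | (t, i) ∈ x.dom →
      x.val t i ∈ H.C ∧ ∃ v ∈ H.F (x.val t i), HasDerivAt (fun s => x.val s i) v t}) := by
    rw [← closure_Ioo hst.ne]
    exact closure_minimal (hd.open_subset_closure_inter isOpen_Ioo) isClosed_closure
  have := (hcont r hr).mono_left (nhdsWithin_mono r (inter_subset_left.trans Ioo_subset_Icc_self :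
    Ioo s t ∩ {t | (t, i) ∈ x.dom →
      x.val t i ∈ H.C ∧ ∃ v ∈ H.F (x.val t i), HasDerivAt (fun s => x.val s i) v t} ⊆ Icc s t))
  have hne := mem_closure_iff_nhdsWithin_neBot.1 (hcl hr)
  refine hC.mem_of_tendsto this ?_
  filter_upwards [self_mem_nhdsWithin] with r' hr'
  exact (hr'.2 (x.isHybridTimeDomain.mem_of_mem_Icc hs ht (Ioo_subset_Icc_self hr'.1))).1

/-- The jump map need not land in `C`. A point outside `C` can only be the outcome of a jump with no
flow after it, and then its predecessor lies in `D ⊆ C` at the same time. -/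
theorem mem_flowSet_or (hx : H.IsSolution x) (hC : IsClosed H.C) (hDC : H.D ⊆ H.C) {t : ℝ} {j : ℕ}
    (ht : (t, j) ∈ x.dom) : x.val t j ∈ H.C ∨
      ∃ i, j = i + 1 ∧ (t, i) ∈ x.dom ∧ x.val t i ∈ H.C := by
  rcases x.isHybridTimeDomain.level_eq_zero_or_exists ht with ⟨s, hs, h⟩ | ⟨rfl, rfl⟩ | ⟨i, rfl, h⟩
  · exact Or.inl (hx.mem_flowSet hC h ht hs ⟨hs.le, le_rfl⟩)
  · exact Or.inl (hx.init.elim id fun h => hDC h)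
  · exact Or.inr ⟨i, rfl, h, hDC (hx.jump t i h ht).1⟩

theorem exists_level_mem_flowSet (hx : H.IsSolution x) (hC : IsClosed H.C) (hDC : H.D ⊆ H.C)
    {s t : ℝ} {j : ℕ} (ht : (t, j) ∈ x.dom) (hs : 0 ≤ s) (hst : s ≤ t) :
    ∃ i ≤ j, (s, i) ∈ x.dom ∧ x.val s i ∈ H.C := by
  obtain ⟨i, hi, h⟩ := x.isHybridTimeDomain.exists_level ht hs hst
  rcases hx.mem_flowSet_or hC hDC h with h' | ⟨n, rfl, h1, h2⟩
  · exact ⟨i, hi, h, h'⟩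
  · exact ⟨n, n.le_succ.trans hi, h1, h2⟩

end HybridSystem.IsSolution

/-! ### Class `𝒦ℒ` bounds from practical stability and practical attractivity -/

/-- The bounds that hold for all small `η` on the values `y` reached at times at least `s` from
initial values at most `r`. -/
def eventualBounds (S : ℝ → ℝ → ℝ → ℝ → Prop) (r s : ℝ) : Set ℝ :=
  {ε | 0 ≤ ε ∧ ∀ᶠ η in 𝓝[>] (0 : ℝ), ∀ r' ≤ r, ∀ s' ≥ s, ∀ y, S η r' s' y → y ≤ ε}

/-- The infimum of the eventual bounds is monotone in both arguments, small for small `r` by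
stability and small for large `s` by attractivity. It is nearly attained only for `η` small
depending on `(r, s)`; uniformity comes from covering the remaining bounded region by finitely many
cells. -/
theorem exists_isClassKL_of_practical (S : ℝ → ℝ → ℝ → ℝ → Prop)
    (hstab : ∀ ε > 0, ∃ δ > 0, ∀ᶠ η in 𝓝[>] (0 : ℝ), ∀ r ≤ δ, ∀ s y, S η r s y → y ≤ ε)
    (hattr : ∀ R, ∀ ε > 0, ∃ M > 0, ∀ᶠ η in 𝓝[>] (0 : ℝ), ∀ r ≤ R, ∀ s y, S η r s y →
      y ≤ M ∧ (M ≤ s → y ≤ ε)) :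
    ∃ β : ℝ → ℝ → ℝ, IsClassKL β ∧ ∀ R, ∀ ν > 0, ∀ᶠ η in 𝓝[>] (0 : ℝ), ∀ r ≤ R, ∀ s ≥ 0, ∀ y,
      0 ≤ r → S η r s y → y ≤ β r s + ν := by
  set b : ℝ → ℝ → ℝ := fun r s => sInf (eventualBounds S r s) with hb
  have hbdd : ∀ r s, BddBelow (eventualBounds S r s) := fun r s => ⟨0, fun ε hε => hε.1⟩
  have hne : ∀ r s, (eventualBounds S r s).Nonempty := by
    intro r s
    obtain ⟨M, hM, h⟩ := hattr r 1 one_pos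
    exact ⟨M, hM.le, h.mono fun η hη r' hr' s' _ y hy => (hη r' hr' s' y hy).1⟩
  have hb0 : ∀ r s, 0 ≤ b r s := fun r s => le_csInf (hne r s) fun ε hε => hε.1
  have hmono : ∀ r₁ r₂ s₁ s₂, r₁ ≤ r₂ → s₂ ≤ s₁ → b r₁ s₁ ≤ b r₂ s₂ := by
    intro r₁ r₂ s₁ s₂ hr hs
    refine csInf_le_csInf (hbdd _ _) (hne _ _) fun ε hε => ⟨hε.1, hε.2.mono ?_⟩
    exact fun η hη r' hr' s' hs' => hη r' (hr'.trans hr) s' (hs.trans hs')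
  have hsmall : ∀ ε > 0, ∃ δ > 0, ∀ r ≤ δ, ∀ s, b r s ≤ ε := by
    intro ε hε
    obtain ⟨δ, hδ, h⟩ := hstab ε hε
    refine ⟨δ, hδ, fun r hr s => csInf_le (hbdd _ _) ⟨hε.le, h.mono ?_⟩⟩
    exact fun η hη r' hr' s' _ y hy => hη r' (hr'.trans hr) s' y hy
  have hlarge : ∀ R, ∀ ε > 0, ∃ M, ∀ s ≥ M, b R s ≤ ε := by
    intro R ε hε
    obtain ⟨M, hM, h⟩ := hattr R ε hε
    refine ⟨M, fun s hs => csInf_le (hbdd _ _) ⟨hε.le, h.mono ?_⟩⟩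
    exact fun η hη r' hr' s' hs' y hy => (hη r' hr' s' y hy).2 (hs.le.trans hs')
  have happrox : ∀ r s, ∀ ν > 0, ∀ᶠ η in 𝓝[>] (0 : ℝ), ∀ r' ≤ r, ∀ s' ≥ s, ∀ y,
      S η r' s' y → y ≤ b r s + ν := by
    intro r s ν hν
    obtain ⟨ε, hε, hlt⟩ := exists_lt_of_csInf_lt (hne r s) (lt_add_of_pos_right (b r s) hν)
    exact hε.2.mono fun η hη r' hr' s' hs' y hy => (hη r' hr' s' hs' y hy).trans hlt.le
  -- Doubling `r` and lowering `s` by one pays for replacing `(r, s)` by the corner of its cell,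
  -- which is dyadic in `r` and of unit length in `s`.
  refine ⟨fun r s => b (2 * r) (s - 1), ⟨fun r s _ _ => hb0 _ _, ?_, ?_, ?_, ?_⟩, ?_⟩
  · exact fun s _ r₁ _ r₂ _ h => hmono _ _ _ _ (by linarith) le_rfl
  · exact fun r _ s₁ _ s₂ _ h => hmono _ _ _ _ le_rfl (by linarith)
  · intro s _
    rw [Metric.tendsto_nhdsWithin_nhds]
    intro ε hε
    obtain ⟨δ, hδ, h⟩ := hsmall (ε / 2) (by linarith)
    refine ⟨δ / 2, by linarith, fun r _ hr => ?_⟩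
    rw [Real.dist_eq, sub_zero] at hr ⊢
    rw [abs_of_nonneg (hb0 _ _)]
    have := h (2 * r) (by linarith [le_abs_self r]) (s - 1)
    linarith
  · intro r _
    rw [Metric.tendsto_atTop]
    intro ε hε
    obtain ⟨M, h⟩ := hlarge (2 * r) (ε / 2) (by linarith)
    refine ⟨M + 1, fun s hs => ?_⟩
    rw [Real.dist_eq, sub_zero, abs_of_nonneg (hb0 _ _)]
    have := h (s - 1) (by linarith)
    linarith
  · intro R ν hν
    -- Stability covers `r ≤ ρ` and attractivity covers `s ≥ M`; cells are needed only for `ρ < r ≤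
    -- R` and `s < M`.
    obtain ⟨ρ, hρ, hst⟩ := hstab ν hν
    obtain ⟨M, hM, hat⟩ := hattr R ν hν
    obtain ⟨K, hK⟩ := pow_unbounded_of_one_lt (R / ρ) (one_lt_two (α := ℝ))
    have hcells : ∀ᶠ η in 𝓝[>] (0 : ℝ), ∀ k ∈ Finset.range K, ∀ l ∈ Finset.range (⌈M⌉₊ + 1),
        ∀ r' ≤ ρ * 2 ^ (k + 1), ∀ s' ≥ (l : ℝ), ∀ y,
          S η r' s' y → y ≤ b (ρ * 2 ^ (k + 1)) l + ν := by
      rw [Filter.eventually_all_finset]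
      intro k _
      rw [Filter.eventually_all_finset]
      intro l _
      exact happrox _ _ _ hν
    filter_upwards [hst, hat, hcells] with η h1 h2 h3 r hr s hs y hr0 hy
    have hβ := hb0 (2 * r) (s - 1)
    rcases le_or_gt r ρ with hrρ | hrρ
    · linarith [h1 r hrρ s y hy]
    rcases le_or_gt M s with hMs | hMs
    · linarith [(h2 r hr s y hy).2 hMs]
    obtain ⟨k, hk1, hk2⟩ := exists_nat_pow_near (one_le_div hρ |>.2 hrρ.le) (one_lt_two (α := ℝ))
    rw [le_div_iff₀ hρ] at hk1
    rw [div_lt_iff₀ hρ] at hk2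
    have hkK : k < K := by
      by_contra! hKk
      have h4 : (2 : ℝ) ^ K ≤ 2 ^ k := pow_le_pow_right₀ one_le_two hKk
      rw [div_lt_iff₀ hρ] at hK
      nlinarith
    have hl : ⌊s⌋₊ < ⌈M⌉₊ + 1 :=
      Nat.lt_succ_of_le ((Nat.floor_le_floor hMs.le).trans (Nat.floor_le_ceil M))
    have h5 := h3 k (Finset.mem_range.2 hkK) ⌊s⌋₊ (Finset.mem_range.2 hl) r
      (by linarith) s (Nat.floor_le hs) y hy
    have h6 : b (ρ * 2 ^ (k + 1)) ⌊s⌋₊ ≤ b (2 * r) (s - 1) := by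
      refine hmono _ _ _ _ ?_ (by linarith [Nat.lt_floor_add_one s])
      rw [pow_succ]
      linarith
    linarith

/-! ### Maximal extensions of solutions without jumps -/

/-- An interval starting at `0` is exhausted by countably many compact ones. This yields hybrid time
domains and lets almost-everywhere statements pass to uncountable unions. -/
theorem exists_monotone_cofinal {I : Set ℝ} (h0 : (0 : ℝ) ∈ I)
    (hI : ∀ t ∈ I, ∀ s, 0 ≤ s → s ≤ t → s ∈ I) :
    ∃ a : ℕ → ℝ, Monotone a ∧ (∀ n, 0 ≤ a n ∧ a n ∈ I) ∧ ∀ t ∈ I, ∃ n, t ≤ a n := by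
  by_cases hb : BddAbove I
  · have hlub := isLUB_csSup ⟨0, h0⟩ hb
    by_cases hs : sSup I ∈ I
    · exact ⟨fun _ => sSup I, monotone_const, fun _ => ⟨hlub.1 h0, hs⟩, fun t ht => ⟨0, hlub.1 ht⟩⟩
    · obtain ⟨u, hu, -, hlim, hmem⟩ := hlub.exists_seq_monotone_tendsto ⟨0, h0⟩
      refine ⟨fun n => max 0 (u n), fun m n h => max_le_max le_rfl (hu h), fun n => ?_,
        fun t ht => ?_⟩
      · refine ⟨le_max_left _ _, ?_⟩
        rcases le_total 0 (u n) with h | h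
        · simpa only [max_eq_right h] using hmem n
        · simpa only [max_eq_left h] using h0
      · have hlt : t < sSup I := lt_of_le_of_ne (hlub.1 ht) fun h => hs (h ▸ ht)
        obtain ⟨n, hn⟩ := (hlim.eventually (lt_mem_nhds hlt)).exists
        exact ⟨n, hn.le.trans (le_max_right _ _)⟩
  · refine ⟨fun n => n, fun m n h => by simpa using h, fun n => ⟨n.cast_nonneg, ?_⟩,
      fun t _ => exists_nat_ge t⟩
    obtain ⟨t, ht, hlt⟩ := not_bddAbove_iff.1 hb n
    exact hI t ht n n.cast_nonneg hlt.le

theorem isHybridTimeDomain_of_continuous {E : Set (ℝ × ℕ)} (h0 : ((0 : ℝ), 0) ∈ E)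
    (hlevel : ∀ t j, (t, j) ∈ E → 0 ≤ t ∧ j = 0)
    (hE : ∀ t, (t, 0) ∈ E → ∀ s, 0 ≤ s → s ≤ t → (s, 0) ∈ E) : IsHybridTimeDomain E := by
  obtain ⟨a, hmono, ha, hcof⟩ := exists_monotone_cofinal (I := {t | (t, 0) ∈ E}) h0 hE
  refine ⟨fun n => {p | p.2 = 0 ∧ 0 ≤ p.1 ∧ p.1 ≤ a n}, ?_, fun n => ?_, ?_⟩
  · exact fun m n hmn p hp => ⟨hp.1, hp.2.1, hp.2.2.trans (hmono hmn)⟩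
  · refine ⟨0, fun i => if i = 0 then 0 else a n, by simp, ?_, ?_⟩
    · intro i j hij
      rcases Nat.eq_zero_or_pos i with rfl | hi
      · by_cases hj : j = 0
        · simp [hj]
        · simpa [hj] using (ha n).1
      · have hj : j ≠ 0 := by omega
        simp [hj, hi.ne']
    · ext ⟨t, j⟩
      constructor
      · rintro ⟨hj, h1, h2⟩
        simp only at hj
        subst hj
        exact ⟨le_rfl, by simpa using h1, by simpa using h2⟩
      · rintro ⟨hj, h1, h2⟩
        have hj0 : j = 0 := Nat.le_zero.1 hj
        subst hj0
        exact ⟨rfl, by simpa using h1, by simpa using h2⟩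
  · ext ⟨t, j⟩
    simp only [mem_iUnion]
    constructor
    · intro h
      obtain ⟨ht, rfl⟩ := hlevel t j h
      obtain ⟨n, hn⟩ := hcof t h
      exact ⟨n, rfl, ht, hn⟩
    · rintro ⟨n, hj, h1, h2⟩
      simp only at hj
      subst hj
      exact hE _ (ha n).2 t h1 h2

namespace HybridArc

variable {X : Type*} [PseudoMetricSpace X]

/-- `y` extends `x`. -/
def Extends (x y : HybridArc X) : Prop :=
  x.dom ⊆ y.dom ∧ ∀ p ∈ x.dom, x.val p.1 p.2 = y.val p.1 p.2

theorem Extends.refl (x : HybridArc X) : x.Extends x := ⟨Subset.rfl, fun _ _ => rfl⟩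

theorem Extends.trans {x y z : HybridArc X} (h : x.Extends y) (h' : y.Extends z) : x.Extends z :=
  ⟨h.1.trans h'.1, fun p hp => (h.2 p hp).trans (h'.2 p (h.1 hp))⟩

end HybridArc

namespace HybridSystem

variable {X : Type*} [NormedAddCommGroup X] [NormedSpace ℝ X] {H : HybridSystem X}

theorem IsSolution.level_eq_zero (hD : H.D = ∅) {x : HybridArc X} (hx : H.IsSolution x)
    {t : ℝ} {j : ℕ} (h : (t, j) ∈ x.dom) : j = 0 := by
  by_contra hj
  obtain ⟨r, -, -, h1, h2⟩ := x.isHybridTimeDomain.exists_jump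
    x.isHybridTimeDomain.zero_mem h (Nat.pos_of_ne_zero hj)
  simpa [hD] using (hx.jump r 0 h1 h2).1

theorem IsSolution.mem_of_le (hD : H.D = ∅) {x : HybridArc X} (hx : H.IsSolution x)
    {s t : ℝ} (h : (t, 0) ∈ x.dom) (hs : 0 ≤ s) (hst : s ≤ t) : (s, 0) ∈ x.dom := by
  obtain ⟨i, -, hi⟩ := x.isHybridTimeDomain.exists_level h hs hst
  exact hx.level_eq_zero hD hi ▸ hi

theorem exists_isSolution_extends_of_isChain (hD : H.D = ∅) {c : Set (HybridArc X)}
    (hne : c.Nonempty) (hc : IsChain HybridArc.Extends c) (hsol : ∀ x ∈ c, H.IsSolution x) :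
    ∃ y, H.IsSolution y ∧ ∀ x ∈ c, x.Extends y := by
  classical
  set I : Set (ℝ × ℕ) := {p | ∃ x ∈ c, p ∈ x.dom} with hI
  have hlevel : ∀ t j, (t, j) ∈ I → 0 ≤ t ∧ j = 0 := by
    rintro t j ⟨x, hx, h⟩
    exact ⟨x.isHybridTimeDomain.time_nonneg h, (hsol x hx).level_eq_zero hD h⟩
  have hdown : ∀ t, (t, 0) ∈ I → ∀ s, 0 ≤ s → s ≤ t → (s, 0) ∈ I := by
    rintro t ⟨x, hx, h⟩ s hs hst
    exact ⟨x, hx, (hsol x hx).mem_of_le hD h hs hst⟩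
  obtain ⟨x₀, hx₀⟩ := hne
  have h0 : ((0 : ℝ), 0) ∈ I := ⟨x₀, hx₀, x₀.isHybridTimeDomain.zero_mem⟩
  set val : ℝ → ℕ → X := fun t j =>
    if h : ∃ x ∈ c, (t, j) ∈ x.dom then h.choose.val t j else 0 with hval
  have hagree : ∀ x ∈ c, ∀ t j, (t, j) ∈ x.dom → x.val t j = val t j := by
    intro x hx t j h
    have hex : ∃ x ∈ c, (t, j) ∈ x.dom := ⟨x, hx, h⟩
    simp only [hval, dif_pos hex]
    obtain ⟨h1, h2⟩ := hex.choose_spec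
    by_cases heq : x = hex.choose
    · rw [← heq]
    · rcases hc hx h1 heq with h3 | h3
      · exact h3.2 (t, j) h
      · exact (h3.2 (t, j) h2).symm
  refine ⟨⟨I, val, isHybridTimeDomain_of_continuous h0 hlevel hdown, ?_⟩, ⟨?_, ?_, ?_⟩, ?_⟩
  · intro j a b hab h
    obtain ⟨x, hx, hb⟩ := h b ⟨hab.le, le_rfl⟩
    obtain rfl := (hsol x hx).level_eq_zero hD hb
    have ha0 := (hlevel a 0 (h a ⟨le_rfl, hab.le⟩)).1
    have hsub : ∀ t ∈ Icc a b, (t, 0) ∈ x.dom := fun t ht =>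
      (hsol x hx).mem_of_le hD hb (ha0.trans ht.1) ht.2
    refine (x.locallyAC 0 a b hab hsub).congr ?_
    rw [uIcc_of_le hab.le]
    exact fun t ht => hagree x hx t 0 (hsub t ht)
  · have := (hsol x₀ hx₀).init
    rwa [hagree x₀ hx₀ 0 0 (x₀.isHybridTimeDomain.zero_mem)] at this
  · intro j
    -- The chain may be uncountable; a cofinal sequence of its members suffices, so only countably
    -- many null sets are discarded.
    obtain ⟨a, -, ha, hcof⟩ := exists_monotone_cofinal (I := {t | (t, 0) ∈ I}) h0 hdown
    choose y hyc hy using fun n => (ha n).2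
    have hae : ∀ᵐ t : ℝ, ∀ n, (t, j) ∈ (y n).dom → (y n).val t j ∈ H.C ∧
        ∃ v ∈ H.F ((y n).val t j), HasDerivAt (fun s => (y n).val s j) v t :=
      ae_all_iff.2 fun n => (hsol _ (hyc n)).flow j
    -- Dropping the endpoints makes `t` interior to the domain of some `y n`, so that the derivative
    -- of the glued curve at `t` is that of `y n`.
    have hne : ∀ᵐ t : ℝ, ∀ n, t ≠ a n :=
      ae_all_iff.2 fun n => by simp [ae_iff, measure_singleton]
    have hn0 : ∀ᵐ t : ℝ, t ≠ 0 := by simp [ae_iff, measure_singleton]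
    filter_upwards [hae, hne, hn0] with t h1 h2 h3 ht
    obtain ⟨ht0, rfl⟩ := hlevel t j ht
    obtain ⟨n, hn⟩ := hcof t ht
    have hmem : ∀ s, 0 ≤ s → s ≤ a n → (s, 0) ∈ (y n).dom := fun s =>
      (hsol _ (hyc n)).mem_of_le hD (hy n)
    obtain ⟨h4, v, hv, hd⟩ := h1 n (hmem t ht0 hn)
    have h5 := hagree _ (hyc n) t 0 (hmem t ht0 hn)
    refine ⟨h5 ▸ h4, v, h5 ▸ hv, hd.congr_of_eventuallyEq ?_⟩
    filter_upwards [Ioo_mem_nhds (lt_of_le_of_ne ht0 h3.symm) (lt_of_le_of_ne hn (h2 n))] with s hs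
    exact (hagree _ (hyc n) s 0 (hmem s hs.1.le hs.2.le)).symm
  · intro t j _ h
    exact absurd (hlevel t (j + 1) h).2 (Nat.succ_ne_zero j)
  · exact fun x hx => ⟨fun p hp => ⟨x, hx, hp⟩, fun p hp => hagree x hx p.1 p.2 hp⟩

/-- Zorn's lemma for the extension order. `UGAS` speaks only of maximal solutions, while the limit
curves are considered on compact intervals. -/
theorem IsSolution.exists_isMaximalSolution_extends (hD : H.D = ∅) {x : HybridArc X}
    (hx : H.IsSolution x) : ∃ y, H.IsMaximalSolution y ∧ x.Extends y := by
  let S := {y : HybridArc X // H.IsSolution y ∧ x.Extends y}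
  have hchain : ∀ c : Set S, IsChain (fun a b : S => a.1.Extends b.1) c →
      ∃ ub : S, ∀ a ∈ c, a.1.Extends ub.1 := by
    intro c hc
    rcases c.eq_empty_or_nonempty with rfl | ⟨a₀, ha₀⟩
    · exact ⟨⟨x, hx, .refl x⟩, by simp⟩
    have hc' : IsChain HybridArc.Extends (Subtype.val '' c) := by
      rintro _ ⟨a, ha, rfl⟩ _ ⟨b, hb, rfl⟩ hab
      exact hc ha hb fun h => hab (h ▸ rfl)
    obtain ⟨y, hy, hext⟩ := exists_isSolution_extends_of_isChain hD (Nonempty.image _ ⟨a₀, ha₀⟩) hc'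
      (by rintro _ ⟨a, -, rfl⟩; exact a.2.1)
    exact ⟨⟨y, hy, a₀.2.2.trans (hext _ ⟨a₀, ha₀, rfl⟩)⟩, fun a ha => hext _ ⟨a, ha, rfl⟩⟩
  obtain ⟨m, hm⟩ := exists_maximal_of_chains_bounded
    (r := fun a b : S => a.1.Extends b.1) hchain fun h h' => h.trans h'
  refine ⟨m.1, ⟨m.2.1, ?_⟩, m.2.2⟩
  rintro ⟨z, hz, hss, hval⟩
  have hmz : m.1.Extends z := ⟨hss.1, hval⟩
  let z' : S := ⟨z, hz, m.2.2.trans hmz⟩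
  exact hss.2 (hm z' hmz).1

/-- A stability bound for maximal solutions of a system without jumps applies to every Lipschitz
curve that solves the differential inclusion on a compact interval. -/
theorem infDist_le_of_lipschitzWith (hD : H.D = ∅) {A : Set X} {β : ℝ → ℝ → ℝ}
    (hβ : ∀ x : HybridArc X, H.IsMaximalSolution x → ∀ (t : ℝ) (j : ℕ), (t, j) ∈ x.dom →
      Metric.infDist (x.val t j) A ≤ β (Metric.infDist (x.val 0 0) A) (t + j))
    {W : ℝ → X} {M : NNReal} {T : ℝ} (hT : 0 ≤ T) (hW : LipschitzWith M W)
    (hC : ∀ t ∈ Icc 0 T, W t ∈ H.C)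
    (hF : ∀ᵐ t : ℝ, t ∈ Ioo 0 T → ∃ v ∈ H.F (W t), HasDerivAt W v t) :
    Metric.infDist (W T) A ≤ β (Metric.infDist (W 0) A) T := by
  let x : HybridArc X :=
    { dom := {p | p.2 = 0 ∧ p.1 ∈ Icc 0 T}
      val := fun t _ => W t
      isHybridTimeDomain := isHybridTimeDomain_of_continuous ⟨rfl, le_rfl, hT⟩
        (fun t j h => ⟨h.2.1, h.1⟩) fun t h s hs hst => ⟨rfl, hs, hst.trans h.2.2⟩
      locallyAC := fun j a b _ _ => hW.lipschitzOnWith.absolutelyContinuousOnInterval }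
  have hx : H.IsSolution x := by
    refine ⟨Or.inl (hC 0 ⟨le_rfl, hT⟩), fun j => ?_, fun t j _ h => ?_⟩
    · have h0 : ∀ᵐ t : ℝ, t ≠ 0 := by simp [ae_iff, measure_singleton]
      have h1 : ∀ᵐ t : ℝ, t ≠ T := by simp [ae_iff, measure_singleton]
      filter_upwards [hF, h0, h1] with t ht h2 h3 hdom
      exact ⟨hC t hdom.2, ht ⟨lt_of_le_of_ne hdom.2.1 h2.symm, lt_of_le_of_ne hdom.2.2 h3⟩⟩
    · exact absurd h.1 (Nat.succ_ne_zero j)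
  obtain ⟨y, hy, hext⟩ := hx.exists_isMaximalSolution_extends hD
  have hTd : (T, 0) ∈ x.dom := ⟨rfl, hT, le_rfl⟩
  have h0d : ((0 : ℝ), 0) ∈ x.dom := ⟨rfl, le_rfl, hT⟩
  have := hβ y hy T 0 (hext.1 hTd)
  rw [← hext.2 _ hTd, ← hext.2 _ h0d] at this
  simpa [x] using this

end HybridSystem

/-! ### Regular inclusions and trajectories with slowly varying parameters -/

/-- A single ultrafilter makes a family of curves converge at all times at once, so no successive or
diagonal extraction of subsequences is needed. -/
theorem IsCompact.exists_tendsto_ultrafilter {α X : Type*} [TopologicalSpace X] {K : Set X}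
    (hK : IsCompact K) (l : Ultrafilter α) {f : α → X} (hf : ∀ᶠ i in l, f i ∈ K) :
    ∃ x ∈ K, Tendsto f l (𝓝 x) :=
  hK.ultrafilter_le_nhds (l.map f) (le_principal_iff.2 hf)

section SlowlyVaryingParameters

variable {E P : Type*} [NormedAddCommGroup E] [NormedSpace ℝ E]
  [PseudoMetricSpace P]

/-- The standing regularity of a parametrized differential inclusion `u' ∈ Φ u q` on `U × Q`. -/
structure RegularInclusion (Φ : E → P → Set E) (U : Set E) (Q : Set P) : Prop where
  isClosed : IsClosed U
  isCompact : IsCompact Q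
  convex : ∀ u ∈ U, ∀ q ∈ Q, Convex ℝ (Φ u q)
  osc : OSCRel (fun p : E × P => Φ p.1 p.2) (U ×ˢ Q)
  lb : LBRel (fun p : E × P => Φ p.1 p.2) (U ×ˢ Q)

/-- A curve `w` on `[0, b]` that solves `w' ∈ Φ w θ`, in the sense of supporting half-spaces, for a
parameter `θ` that varies slowly up to jumps. -/
structure SlowTrajectory (Φ : E → P → Set E) (U : Set E) (Q : Set P) (ε b : ℝ) (w : ℝ → E)
    (θ : ℝ → P) : Prop where
  nonneg : 0 ≤ b
  mem_left : ∀ t ∈ Icc 0 b, w t ∈ U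
  mem_right : ∀ t ∈ Icc 0 b, θ t ∈ Q
  bounded : ∃ R, ∀ t ∈ Icc 0 b, ‖w t‖ ≤ R
  slow : ∀ s ∈ Icc 0 b, ∀ t ∈ Icc 0 b, dist (θ s) (θ t) ≤ ε * (1 + |s - t|)
  -- This integrated form involves no derivative of `w`, survives pointwise limits and is
  -- insensitive to jumps of `θ`.
  inclusion : ∀ (ℓ : E →L[ℝ] ℝ) (c : ℝ), ∀ s ∈ Icc 0 b, ∀ t ∈ Icc 0 b, s ≤ t →
    (∀ r ∈ Icc s t, ∀ v ∈ Φ (w r) (θ r), ℓ v ≤ c) → ℓ (w t) - ℓ (w s) ≤ c * (t - s)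

namespace RegularInclusion

variable {Φ : E → P → Set E} {U : Set E} {Q : Set P}

theorem exists_bound [FiniteDimensional ℝ E] (h : RegularInclusion Φ U Q) (R : ℝ) :
    ∃ M > 0, ∀ u ∈ U, ‖u‖ ≤ R → ∀ q ∈ Q, ∀ v ∈ Φ u q, ‖v‖ ≤ M := by
  have hK : IsCompact ((U ∩ Metric.closedBall 0 R) ×ˢ Q) :=
    ((isCompact_closedBall (0 : E) R).inter_left h.isClosed).prod h.isCompact
  have key : ∃ M > 0, ∀ p ∈ (U ∩ Metric.closedBall 0 R) ×ˢ Q, p ∈ U ×ˢ Q →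
      ∀ v ∈ Φ p.1 p.2, ‖v‖ ≤ M := by
    refine hK.induction_on (p := fun S => ∃ M > 0, ∀ p ∈ S, p ∈ U ×ˢ Q →
      ∀ v ∈ Φ p.1 p.2, ‖v‖ ≤ M) ⟨1, one_pos, by simp⟩ ?_ ?_ ?_
    · rintro s t hst ⟨M, hM, h1⟩
      exact ⟨M, hM, fun p hp => h1 p (hst hp)⟩
    · rintro s t ⟨M, hM, h1⟩ ⟨N, hN, h2⟩
      refine ⟨max M N, lt_max_of_lt_left hM, ?_⟩
      rintro p (hp | hp) hpU v hv
      · exact (h1 p hp hpU v hv).trans (le_max_left _ _)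
      · exact (h2 p hp hpU v hv).trans (le_max_right _ _)
    · rintro p ⟨hp1, hp2⟩
      obtain ⟨N, hN, hpN, hbd⟩ := h.lb p ⟨hp1.1, hp2⟩
      obtain ⟨M, hM⟩ := hbd.exists_norm_le
      refine ⟨N, mem_nhdsWithin_of_mem_nhds (hN.mem_nhds hpN), max M 1, by simp, ?_⟩
      exact fun p' hp' hU v hv => (hM v (mem_biUnion ⟨hp', hU⟩ hv)).trans (le_max_left _ _)
  obtain ⟨M, hM, h1⟩ := key
  exact ⟨M, hM, fun u hu hR q hq v hv =>
    h1 (u, q) ⟨⟨hu, by simpa using hR⟩, hq⟩ ⟨hu, hq⟩ v hv⟩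

theorem isClosed_image (h : RegularInclusion Φ U Q) {u : E} {q : P} (hu : u ∈ U) (hq : q ∈ Q) :
    IsClosed (Φ u q) :=
  IsSeqClosed.isClosed fun ss s hss hs =>
    h.osc (u, q) ⟨hu, hq⟩ (fun _ => (u, q)) ss s (fun _ => ⟨hu, hq⟩) hss tendsto_const_nhds hs

/-- Upper semicontinuity of the values: velocities violating the bound at nearby points would be
bounded, and outer semicontinuity would put a limit of them in `Φ u q`. -/
theorem eventually_lt [FiniteDimensional ℝ E] (h : RegularInclusion Φ U Q) {u : E} {q : P}
    (hu : u ∈ U) (hq : q ∈ Q) (ℓ : E →L[ℝ] ℝ) {c : ℝ} (hc : ∀ v ∈ Φ u q, ℓ v < c) :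
    ∃ ρ > 0, ∀ u' ∈ U, ∀ q' ∈ Q, dist u' u < ρ → dist q' q < ρ → ∀ v ∈ Φ u' q', ℓ v < c := by
  by_contra! hcon
  choose us hus qs hqs hdu hdq ss hss hcs using
    fun i : ℕ => hcon (1 / ((i : ℝ) + 1)) Nat.one_div_pos_of_nat
  have hlim := tendsto_one_div_add_atTop_nhds_zero_nat (𝕜 := ℝ)
  have hul : Tendsto us atTop (𝓝 u) := tendsto_iff_dist_tendsto_zero.2
    (squeeze_zero (fun _ => dist_nonneg) (fun i => (hdu i).le) hlim)
  have hql : Tendsto qs atTop (𝓝 q) := tendsto_iff_dist_tendsto_zero.2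
    (squeeze_zero (fun _ => dist_nonneg) (fun i => (hdq i).le) hlim)
  obtain ⟨M, hM, hbd⟩ := h.exists_bound (‖u‖ + 1)
  have hsb : ∀ i, ss i ∈ Metric.closedBall (0 : E) M := by
    intro i
    have h1 : dist (us i) u ≤ 1 := (hdu i).le.trans (by
      rw [div_le_one (by positivity)]
      linarith [i.cast_nonneg (α := ℝ)])
    have h2 : ‖us i‖ ≤ ‖u‖ + 1 := by
      have := norm_le_norm_add_norm_sub' (us i) u
      rw [dist_eq_norm] at h1
      linarith
    simpa using hbd _ (hus i) h2 _ (hqs i) _ (hss i)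
  obtain ⟨s, -, φ, hφ, hs⟩ := (isCompact_closedBall (0 : E) M).tendsto_subseq hsb
  have hmem := h.osc (u, q) ⟨hu, hq⟩ (fun i => (us (φ i), qs (φ i))) (fun i => ss (φ i)) s
    (fun i => ⟨hus _, hqs _⟩) (fun i => hss _)
    ((hul.comp hφ.tendsto_atTop).prodMk_nhds (hql.comp hφ.tendsto_atTop)) hs
  exact absurd (ge_of_tendsto' ((ℓ.continuous.tendsto s).comp hs) fun i => hcs (φ i))
    (not_le.2 (hc s hmem))

end RegularInclusion

namespace SlowTrajectory

variable {Φ : E → P → Set E} {U : Set E} {Q : Set P} {ε b : ℝ} {w : ℝ → E} {θ : ℝ → P}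

theorem eps_nonneg (h : SlowTrajectory Φ U Q ε b w θ) : 0 ≤ ε := by
  have := h.slow 0 ⟨le_rfl, h.nonneg⟩ 0 ⟨le_rfl, h.nonneg⟩
  simpa using dist_nonneg.trans this

theorem shift (h : SlowTrajectory Φ U Q ε b w θ) {a d : ℝ} (ha : 0 ≤ a) (hd : 0 ≤ d)
    (had : a + d ≤ b) : SlowTrajectory Φ U Q ε d (fun t => w (a + t)) (fun t => θ (a + t)) := by
  have hmem : ∀ t ∈ Icc 0 d, a + t ∈ Icc 0 b := fun t ht =>
    ⟨add_nonneg ha ht.1, (add_le_add_right ht.2 a).trans had⟩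
  obtain ⟨R, hR⟩ := h.bounded
  refine ⟨hd, fun t ht => h.mem_left _ (hmem t ht), fun t ht => h.mem_right _ (hmem t ht),
    ⟨R, fun t ht => hR _ (hmem t ht)⟩, fun s hs t ht => ?_, fun ℓ c s hs t ht hst hv => ?_⟩
  · simpa using h.slow _ (hmem s hs) _ (hmem t ht)
  · have := h.inclusion ℓ c _ (hmem s hs) _ (hmem t ht) (by linarith) fun r hr v hv' =>
      hv (r - a) ⟨by linarith [hr.1], by linarith [hr.2]⟩ v (by simpa using hv')
    simpa using this

theorem restrict (h : SlowTrajectory Φ U Q ε b w θ) {d : ℝ} (hd : 0 ≤ d) (hdb : d ≤ b) :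
    SlowTrajectory Φ U Q ε d w θ := by
  simpa using h.shift le_rfl hd (by simpa using hdb)

/-- The inclusion is tested on a functional norming `w t - w s`, with `c = M`. -/
theorem dist_le (h : SlowTrajectory Φ U Q ε b w θ) {R M : ℝ}
    (hM : ∀ u ∈ U, ‖u‖ ≤ R → ∀ q ∈ Q, ∀ v ∈ Φ u q, ‖v‖ ≤ M) (hR : ∀ t ∈ Icc 0 b, ‖w t‖ ≤ R) :
    ∀ s ∈ Icc 0 b, ∀ t ∈ Icc 0 b, dist (w s) (w t) ≤ M * |s - t| := by
  have key : ∀ s ∈ Icc 0 b, ∀ t ∈ Icc 0 b, s ≤ t → dist (w s) (w t) ≤ M * |s - t| := by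
    intro s hs t ht hst
    obtain ⟨ℓ, hℓ, hval⟩ := exists_dual_vector'' ℝ (w t - w s)
    have := h.inclusion ℓ M s hs t ht hst fun r hr v hv => by
      have hr' : r ∈ Icc 0 b := ⟨hs.1.trans hr.1, hr.2.trans ht.2⟩
      have h1 := hM _ (h.mem_left r hr') (hR r hr') _ (h.mem_right r hr') v hv
      calc ℓ v ≤ ‖ℓ v‖ := Real.le_norm_self _
        _ ≤ ‖ℓ‖ * ‖v‖ := ℓ.le_opNorm v
        _ ≤ 1 * ‖v‖ := by gcongr
        _ ≤ M := by simpa using h1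
    rw [← map_sub, hval] at this
    rw [dist_comm, dist_eq_norm, abs_sub_comm, abs_of_nonneg (sub_nonneg.2 hst)]
    exact this
  intro s hs t ht
  rcases le_total s t with h1 | h1
  · exact key s hs t ht h1
  · rw [dist_comm, abs_sub_comm]
    exact key t ht s hs h1

/-- Limits of trajectories along an ultrafilter, as the variation of the parameter vanishes, solve
the differential inclusion with a frozen parameter. -/
theorem exists_limit [FiniteDimensional ℝ E] (hΦ : RegularInclusion Φ U Q) {l : Ultrafilter ℕ}
    {ε b : ℕ → ℝ} {w : ℕ → ℝ → E} {θ : ℕ → ℝ → P} {q : P} {T R : ℝ} (hq : q ∈ Q) (hε : Tendsto ε l (𝓝 0))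
    (hb : Tendsto b l (𝓝 T)) (hθ : Tendsto (fun i => θ i 0) l (𝓝 q))
    (h : ∀ᶠ i in l, SlowTrajectory Φ U Q (ε i) (b i) (w i) (θ i))
    (hR : ∀ᶠ i in l, ∀ t ∈ Icc 0 (b i), ‖w i t‖ ≤ R) :
    ∃ (W : ℝ → E) (M : NNReal), LipschitzWith M W ∧ (∀ t, W t ∈ U) ∧
      (∀ᵐ t : ℝ, t ∈ Ioo 0 T → ∃ v ∈ Φ (W t) q, HasDerivAt W v t) ∧
      Tendsto (fun i => w i 0) l (𝓝 (W 0)) ∧ Tendsto (fun i => w i (b i)) l (𝓝 (W T)) := by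
  obtain ⟨M, hM0, hM⟩ := hΦ.exists_bound R
  have hT : 0 ≤ T := ge_of_tendsto hb (h.mono fun i hi => hi.nonneg)
  -- The interval `[0, b i]` varies with `i`; clamping time to it makes all curves globally defined
  -- with a common Lipschitz constant.
  set κ : ℕ → ℝ → ℝ := fun i t => max 0 (min t (b i)) with hκ
  have hκmem : ∀ i t, 0 ≤ b i → κ i t ∈ Icc 0 (b i) := fun i t hi =>
    ⟨le_max_left _ _, max_le hi (min_le_right _ _)⟩
  have hκlip : ∀ i s t, |κ i s - κ i t| ≤ |s - t| := by
    intro i s t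
    have h1 : |κ i s - κ i t| ≤ |min s (b i) - min t (b i)| := by
      simpa using abs_max_sub_max_le_max 0 (min s (b i)) 0 (min t (b i))
    have h2 : |min s (b i) - min t (b i)| ≤ |s - t| := by
      simpa using abs_min_sub_min_le_max s (b i) t (b i)
    exact h1.trans h2
  have hlim : ∀ t, ∃ a ∈ U, Tendsto (fun i => w i (κ i t)) l (𝓝 a) := by
    intro t
    obtain ⟨a, ha, hl⟩ := ((isCompact_closedBall (0 : E) R).inter_left
      hΦ.isClosed).exists_tendsto_ultrafilter l (f := fun i => w i (κ i t)) (by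
        filter_upwards [h, hR] with i h1 h2
        exact ⟨h1.mem_left _ (hκmem i t h1.nonneg),
          by simpa using h2 _ (hκmem i t h1.nonneg)⟩)
    exact ⟨a, ha.1, hl⟩
  choose W hWU hW using hlim
  have hlip : ∀ᶠ i in l, ∀ s t, dist (w i (κ i s)) (w i (κ i t)) ≤ M * |s - t| := by
    filter_upwards [h, hR] with i h1 h2 s t
    exact (h1.dist_le hM h2 _ (hκmem i s h1.nonneg) _ (hκmem i t h1.nonneg)).trans
      (mul_le_mul_of_nonneg_left (hκlip i s t) hM0.le)
  have hWlip : LipschitzWith M.toNNReal W := by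
    refine LipschitzWith.of_dist_le_mul fun s t => ?_
    rw [Real.coe_toNNReal M hM0.le, Real.dist_eq]
    exact le_of_tendsto ((hW s).dist (hW t)) (hlip.mono fun i hi => hi s t)
  refine ⟨W, M.toNNReal, hWlip, hWU, ?_, ?_, ?_⟩
  · filter_upwards [hWlip.ae_differentiableAt_real] with t hd ht
    refine ⟨deriv W t, ?_, hd.hasDerivAt⟩
    -- Otherwise a hyperplane strictly separates `deriv W t` from the closed convex set `Φ (W t) q`.
    -- Near `(W t, q)` all velocities stay in the half-space `ℓ < c`, so the right slopes of `ℓ ∘ W`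
    -- at `t` are at most `c`, contradicting `c < ℓ (deriv W t)`.
    by_contra hnot
    obtain ⟨ℓ, c, hlt, hgt⟩ := geometric_hahn_banach_closed_point (hΦ.convex _ (hWU t) q hq)
      (hΦ.isClosed_image (hWU t) hq) hnot
    obtain ⟨ρ, hρ, husc⟩ := hΦ.eventually_lt (hWU t) hq ℓ hlt
    have hslope : ∀ᶠ s in 𝓝[>] t, slope (fun s => ℓ (W s)) t s ≤ c := by
      have hnear : ∀ᶠ s in 𝓝[>] t, s ∈ Ioo t (min T (t + ρ / (4 * M))) :=
        Ioo_mem_nhdsGT (lt_min ht.2 (by have : 0 < ρ / (4 * M) := by positivity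
                                        linarith))
      filter_upwards [hnear] with s hs
      have hsT := hs.2.trans_le (min_le_left _ _)
      -- One half of `ρ` is for the displacement during `[t, s]`, the other for the distance from `w
      -- i t` to its limit `W t`.
      have hsρ : M * (s - t) < ρ / 2 := by
        have := hs.2.trans_le (min_le_right _ _)
        have h1 : s - t < ρ / (4 * M) := by linarith
        rw [lt_div_iff₀ (by positivity)] at h1
        nlinarith
      have hle : ℓ (W s) - ℓ (W t) ≤ c * (s - t) := by
        refine le_of_tendsto (((ℓ.continuous.tendsto _).comp (hW s)).sub
          ((ℓ.continuous.tendsto _).comp (hW t))) ?_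
        have hθ' : ∀ᶠ i in l, dist (θ i 0) q + ε i * (1 + T) < ρ := by
          have : Tendsto (fun i => dist (θ i 0) q + ε i * (1 + T)) l (𝓝 (dist q q + 0 * (1 + T))) :=
            (hθ.dist tendsto_const_nhds).add (hε.mul_const _)
          rw [dist_self, zero_mul, add_zero] at this
          exact this.eventually (gt_mem_nhds hρ)
        have hWt : ∀ᶠ i in l, dist (w i (κ i t)) (W t) < ρ / 2 :=
          (Metric.tendsto_nhds.1 (hW t)) _ (by positivity)
        filter_upwards [h, hlip, hθ', hWt, hb.eventually (lt_mem_nhds hsT)] with i h1 h2 h3 h4 h5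
        have hid : ∀ r ∈ Icc t s, κ i r = r ∧ r ∈ Icc 0 (b i) := by
          intro r hr
          have hrb : r ≤ b i := hr.2.trans h5.le
          have hr0 : 0 ≤ r := ht.1.le.trans hr.1
          exact ⟨by simp only [hκ, min_eq_left hrb, max_eq_right hr0], hr0, hrb⟩
        have hs' := hid s ⟨hs.1.le, le_rfl⟩
        have ht' := hid t ⟨le_rfl, hs.1.le⟩
        simp only [Function.comp_apply, hs'.1, ht'.1]
        refine h1.inclusion ℓ c t ht'.2 s hs'.2 hs.1.le fun r hr v hv => ?_
        have hr' := hid r hr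
        refine (husc _ (h1.mem_left r hr'.2) _ (h1.mem_right r hr'.2) ?_ ?_ v hv).le
        · have h6 := h2 r t
          rw [hr'.1, abs_of_nonneg (sub_nonneg.2 hr.1)] at h6
          have h7 := dist_triangle (w i r) (w i (κ i t)) (W t)
          have h8 : M * (r - t) ≤ M * (s - t) := by
            have := hr.2
            gcongr
          linarith
        · have h6 := h1.slow r hr'.2 0 ⟨le_rfl, h1.nonneg⟩
          rw [sub_zero, abs_of_nonneg hr'.2.1] at h6
          have h7 := dist_triangle (θ i r) (θ i 0) q
          have h8 : ε i * (1 + r) ≤ ε i * (1 + T) := by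
            have := h1.eps_nonneg
            have := hr.2
            gcongr
            linarith
          linarith
      rw [slope_def_field, div_le_iff₀ (sub_pos.2 hs.1)]
      exact hle
    have hder : HasDerivWithinAt (fun s => ℓ (W s)) (ℓ (deriv W t)) (Ioi t) t :=
      (ℓ.hasFDerivAt.comp_hasDerivAt t hd.hasDerivAt).hasDerivWithinAt
    rw [hasDerivWithinAt_iff_tendsto_slope' (by simp)] at hder
    exact absurd (le_of_tendsto hder hslope) (not_le.2 hgt)
  · refine (hW 0).congr' ?_
    filter_upwards [h] with i hi
    simp only [hκ, min_eq_left hi.nonneg, max_self]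
  · rw [tendsto_iff_dist_tendsto_zero]
    have hz : Tendsto (fun i => M * |b i - T| + dist (w i (κ i T)) (W T)) l (𝓝 0) := by
      have h1 := (hb.sub_const T).abs.const_mul M
      have h2 := (hW T).dist (tendsto_const_nhds (x := W T))
      simpa using h1.add h2
    refine squeeze_zero' (.of_forall fun i => dist_nonneg) ?_ hz
    filter_upwards [h, hlip] with i h1 h2
    have h3 := h2 (b i) T
    have h4 : κ i (b i) = b i := by simp only [hκ, min_self, max_eq_right h1.nonneg]
    rw [h4] at h3
    linarith [dist_triangle (w i (b i)) (w i (κ i T)) (W T)]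

end SlowTrajectory

end SlowlyVaryingParameters

/-! ### Practical stability and attractivity under slowly varying parameters -/

/-- `g` may jump, so there may be no exact exit time. Instead `t` is taken just after the infimum of
the times with `g > a`: any earlier such time lies within `2 * h` of a time where `g ≤ a`, and the
growth in between is at most one. -/
theorem exists_first_exit {g : ℝ → ℝ} {a b L : ℝ} (hb : 0 ≤ b)
    (hg : ∀ s ∈ Icc 0 b, ∀ t ∈ Icc 0 b, s ≤ t → g t ≤ g s + L * (t - s) + 1 / 2)
    (h0 : g 0 ≤ a) (hgb : a < g b) :
    ∃ t ∈ Icc 0 b, a < g t ∧ ∀ s ∈ Icc 0 t, g s ≤ a + 1 := by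
  set S : Set ℝ := {t | t ∈ Icc 0 b ∧ a < g t} with hS
  have hne : S.Nonempty := ⟨b, ⟨hb, le_rfl⟩, hgb⟩
  have hbdd : BddBelow S := ⟨0, fun t ht => ht.1.1⟩
  -- Chosen so that `L * (2 * h) ≤ 1 / 2`, which leaves `1 / 2` for the jumps of `g`.
  set h : ℝ := 1 / (4 * (|L| + 1)) with hh
  have hpos : 0 < h := by positivity
  have hLh : L * (2 * h) ≤ 1 / 2 := by
    have h1 : (|L| + 1) * h = 1 / 4 := by
      rw [hh]
      field_simp
    nlinarith [le_abs_self L]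
  obtain ⟨t, htS, ht⟩ := exists_lt_of_csInf_lt hne (lt_add_of_pos_right (sInf S) hpos)
  refine ⟨t, htS.1, htS.2, fun s hs => ?_⟩
  have hsb : s ∈ Icc 0 b := ⟨hs.1, hs.2.trans htS.1.2⟩
  by_cases hsS : s ∈ S
  · have hinf : sInf S ≤ s := csInf_le hbdd hsS
    have hr : max 0 (sInf S - h) ∈ Icc 0 b ∧ max 0 (sInf S - h) ∉ S ∧
        max 0 (sInf S - h) ≤ s ∧ sInf S - h ≤ max 0 (sInf S - h) := by
      have hle : max 0 (sInf S - h) ≤ s := max_le hs.1 (by linarith)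
      refine ⟨⟨le_max_left _ _, hle.trans hsb.2⟩, fun hmem => ?_, hle, le_max_right _ _⟩
      rcases le_total 0 (sInf S - h) with h1 | h1
      · rw [max_eq_right h1] at hmem
        linarith [csInf_le hbdd hmem]
      · rw [max_eq_left h1] at hmem
        exact absurd hmem.2 (not_lt.2 h0)
    obtain ⟨h1, h2, h3, h4⟩ := hr
    have h5 : g (max 0 (sInf S - h)) ≤ a := by
      by_contra! h6
      exact h2 ⟨h1, h6⟩
    have h6 := hg _ h1 _ hsb h3
    have h7 : L * (s - max 0 (sInf S - h)) ≤ 1 / 2 := by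
      have h8 : s - max 0 (sInf S - h) ≤ 2 * h := by linarith [hs.2]
      rcases le_total L 0 with h9 | h9
      · nlinarith
      · exact (mul_le_mul_of_nonneg_left h8 h9).trans hLh
    linarith
  · have : g s ≤ a := by
      by_contra! h6
      exact hsS ⟨hsb, h6⟩
    linarith

/-- Class `𝒦ℒ` prescribes only the limit as `r → 0⁺`; monotonicity and nonnegativity determine the
value at `0`. -/
theorem IsClassKL.zero_left {β : ℝ → ℝ → ℝ} (hβ : IsClassKL β) {s : ℝ} (hs : 0 ≤ s) :
    β 0 s = 0 := by
  refine le_antisymm (ge_of_tendsto (hβ.tendsto_fst s hs) ?_) (hβ.nonneg 0 s le_rfl hs)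
  filter_upwards [self_mem_nhdsWithin] with r hr
  exact hβ.mono s hs self_mem_Ici (mem_Ici.2 (le_of_lt hr)) (le_of_lt hr)

/-- The points `(u, q)` with `q ∈ Q` and `u ∈ O q`. -/
def fiberedSet {E P : Type*} (Q : Set P) (O : P → Set E) : Set (E × P) :=
  {p | p.2 ∈ Q ∧ p.1 ∈ O p.2}

theorem infDist_fiberedSet_le {E P : Type*} [PseudoMetricSpace E] [PseudoMetricSpace P]
    {Q : Set P} {O : P → Set E} (u u' : E) (q q' : P) :
    Metric.infDist (u, q) (fiberedSet Q O) ≤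
      Metric.infDist (u', q') (fiberedSet Q O) + (dist u u' + dist q q') := by
  refine (Metric.infDist_le_infDist_add_dist (y := (u', q'))).trans ?_
  gcongr
  exact max_le_add_of_nonneg dist_nonneg dist_nonneg

theorem tendsto_infDist_fiberedSet {α E P : Type*} [PseudoMetricSpace E] [PseudoMetricSpace P]
    {Q : Set P} {O : P → Set E} {l : Filter α} {w : α → E} {θ : α → P} {u : E}
    {q : P} (hw : Tendsto w l (𝓝 u)) (hθ : Tendsto θ l (𝓝 q)) :
    Tendsto (fun i => Metric.infDist (w i, θ i) (fiberedSet Q O)) l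
      (𝓝 (Metric.infDist (u, q) (fiberedSet Q O))) :=
  ((Metric.continuous_infDist_pt _).tendsto _).comp (hw.prodMk_nhds hθ)

section SlowlyVaryingParameters

variable {E P : Type*} [NormedAddCommGroup E] [NormedSpace ℝ E] [MetricSpace P]

/-- For each frozen parameter `q ∈ Q`, the compact nonempty set `O q` satisfies a `𝒦ℒ` bound along
the Lipschitz solutions of `u' ∈ Φ u q` in `U`. -/
def FrozenStable (Φ : E → P → Set E) (U : Set E) (Q : Set P) (O : P → Set E) : Prop :=
  ∀ q ∈ Q, IsCompact (O q) ∧ (O q).Nonempty ∧ ∃ β, IsClassKL β ∧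
    ∀ (W : ℝ → E) (M : NNReal) (T : ℝ), 0 ≤ T → LipschitzWith M W → (∀ t, W t ∈ U) →
      (∀ᵐ t : ℝ, t ∈ Ioo 0 T → ∃ v ∈ Φ (W t) q, HasDerivAt W v t) →
      Metric.infDist (W T) (O q) ≤ β (Metric.infDist (W 0) (O q)) T

variable {Φ : E → P → Set E} {U : Set E} {Q : Set P} {O : P → Set E}

/-- By compactness of the fibered set, one `C` bounds the norms of the points of all `O q`, so norms
and both distances are comparable uniformly in `q`. -/
theorem exists_norm_bounds (hO : IsCompact (fiberedSet Q O)) (hS : FrozenStable Φ U Q O) :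
    ∃ C ≥ 0, ∀ u, ∀ q ∈ Q, ‖u‖ ≤ Metric.infDist (u, q) (fiberedSet Q O) + C ∧
      ‖u‖ ≤ Metric.infDist u (O q) + C ∧ Metric.infDist u (O q) ≤ ‖u‖ + C ∧
      Metric.infDist (u, q) (fiberedSet Q O) ≤ Metric.infDist u (O q) := by
  obtain ⟨C, hC⟩ := (hO.image continuous_fst).isBounded.exists_norm_le
  have hC' : ∀ q ∈ Q, ∀ p ∈ O q, ‖p‖ ≤ max C 0 := fun q hq p hp =>
    (hC p ⟨(p, q), ⟨hq, hp⟩, rfl⟩).trans (le_max_left _ _)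
  refine ⟨max C 0, le_max_right _ _, fun u q hq => ?_⟩
  obtain ⟨hc, hne, -⟩ := hS q hq
  obtain ⟨p, hp, hpd⟩ := hc.exists_infDist_eq_dist hne u
  have hpO : (p, q) ∈ fiberedSet Q O := ⟨hq, hp⟩
  obtain ⟨⟨p', q'⟩, hp', hpd'⟩ := hO.exists_infDist_eq_dist ⟨_, hpO⟩ (u, q)
  have hnorm : ∀ p : E, ‖u‖ ≤ dist u p + ‖p‖ := fun p => by
    rw [dist_eq_norm]
    linarith [norm_le_norm_add_norm_sub' u p]
  refine ⟨?_, ?_, ?_, ?_⟩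
  · have h1 : dist u p' ≤ dist (u, q) (p', q') := le_max_left _ _
    linarith [hnorm p', hC' q' hp'.1 p' hp'.2]
  · linarith [hnorm p, hC' q hq p hp]
  · rw [hpd, dist_eq_norm]
    linarith [norm_sub_le u p, hC' q hq p hp]
  · have := Metric.infDist_le_dist_of_mem (x := (u, q)) hpO
    rw [Prod.dist_eq, dist_self, max_eq_left dist_nonneg] at this
    rwa [hpd]

/-- Over time gaps of bounded length the drift of the parameter vanishes with `ε`, so its limit is
the same at either end of a window. -/
theorem SlowTrajectory.tendsto_parameter {l : Filter ℕ} {ε b : ℕ → ℝ} {w : ℕ → ℝ → E}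
    {θ : ℕ → ℝ → P} {q : P} {s t : ℕ → ℝ} {N : ℝ}
    (h : ∀ᶠ i in l, SlowTrajectory Φ U Q (ε i) (b i) (w i) (θ i)) (hε : Tendsto ε l (𝓝 0))
    (hs : ∀ᶠ i in l, s i ∈ Icc 0 (b i)) (ht : ∀ᶠ i in l, t i ∈ Icc 0 (b i))
    (hN : ∀ᶠ i in l, |s i - t i| ≤ N) (hθ : Tendsto (fun i => θ i (t i)) l (𝓝 q)) :
    Tendsto (fun i => θ i (s i)) l (𝓝 q) := by
  rw [tendsto_iff_dist_tendsto_zero] at hθ ⊢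
  have hz : Tendsto (fun i => ε i * (1 + N) + dist (θ i (t i)) q) l (𝓝 0) := by
    simpa using (hε.mul_const (1 + N)).add hθ
  refine squeeze_zero' (.of_forall fun i => dist_nonneg) ?_ hz
  filter_upwards [h, hs, ht, hN] with i h1 h2 h3 h4
  have h5 := h1.slow _ h2 _ h3
  have h6 : ε i * (1 + |s i - t i|) ≤ ε i * (1 + N) :=
    mul_le_mul_of_nonneg_left (by linarith) h1.eps_nonneg
  linarith [dist_triangle (θ i (s i)) (θ i (t i)) q]

variable [FiniteDimensional ℝ E]

/-- Trajectories violating the claim are stopped at an approximate exit time `T i`, which keeps them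
bounded. The limit `a` of their endpoints must lie at distance at least `ε` from the fibered set,
yet frozen stability at the limit parameter `q` puts it at distance zero from `O q`. -/
theorem FrozenStable.practically_stable (hS : FrozenStable Φ U Q O)
    (hΦ : RegularInclusion Φ U Q) (hO : IsCompact (fiberedSet Q O)) {ε : ℝ} (hε : 0 < ε) :
    ∃ δ > 0, ∀ (ε' b : ℝ) (w : ℝ → E) (θ : ℝ → P), ε' ≤ δ → SlowTrajectory Φ U Q ε' b w θ →
      Metric.infDist (w 0, θ 0) (fiberedSet Q O) ≤ δ →
      Metric.infDist (w b, θ b) (fiberedSet Q O) ≤ ε := by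
  obtain ⟨C, hC0, hC⟩ := exists_norm_bounds hO hS
  by_contra! hcon
  -- `1 / 2` matches the jump allowance of `exists_first_exit`, `ε` makes the start lie below the
  -- exit level, and `1 / (i + 1)` forces convergence.
  set δ : ℕ → ℝ := fun i => min (1 / 2) (min ε (1 / ((i : ℝ) + 1))) with hδ
  have hδ0 : ∀ i, 0 < δ i := fun i => lt_min (by norm_num) (lt_min hε Nat.one_div_pos_of_nat)
  choose ε' b w θ hε' htraj hD0 hDb using fun i => hcon (δ i) (hδ0 i)
  have hexit : ∀ i, ∃ t ∈ Icc 0 (b i), ε < Metric.infDist (w i t, θ i t) (fiberedSet Q O) ∧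
      ∀ s ∈ Icc 0 t, Metric.infDist (w i s, θ i s) (fiberedSet Q O) ≤ ε + 1 := by
    intro i
    obtain ⟨R, hR⟩ := (htraj i).bounded
    obtain ⟨M, hM0, hM⟩ := hΦ.exists_bound R
    refine exists_first_exit (L := M + 1 / 2) (htraj i).nonneg (fun s hs t ht hst => ?_)
      ((hD0 i).trans ((min_le_right _ _).trans (min_le_left _ _))) (hDb i)
    have h1 := (htraj i).dist_le hM hR t ht s hs
    have h2 := (htraj i).slow t ht s hs
    rw [abs_of_nonneg (sub_nonneg.2 hst)] at h1 h2
    have h3 : ε' i * (1 + (t - s)) ≤ 1 / 2 * (1 + (t - s)) :=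
      mul_le_mul_of_nonneg_right ((hε' i).trans (min_le_left _ _)) (by linarith)
    linarith [infDist_fiberedSet_le (Q := Q) (O := O) (w i t) (w i s) (θ i t) (θ i s)]
  choose T hT hDT hDle using hexit
  have hres : ∀ i, SlowTrajectory Φ U Q (ε' i) (T i) (w i) (θ i) := fun i =>
    (htraj i).restrict (hT i).1 (hT i).2
  have hTT : ∀ i, T i ∈ Icc 0 (T i) := fun i => ⟨(hT i).1, le_rfl⟩
  have hnorm : ∀ i, ∀ t ∈ Icc 0 (T i), ‖w i t‖ ≤ ε + 1 + C := fun i t ht => by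
    linarith [(hC (w i t) _ ((hres i).mem_right t ht)).1, hDle i t ht]
  set l := hyperfilter ℕ with hl
  have hδl : Tendsto δ l (𝓝 0) := by
    refine (squeeze_zero (fun i => (hδ0 i).le)
      (fun i => (min_le_right _ _).trans (min_le_right _ _))
      (tendsto_one_div_add_atTop_nhds_zero_nat (𝕜 := ℝ))).mono_left Nat.hyperfilter_le_atTop
  have hεl : Tendsto ε' l (𝓝 0) := squeeze_zero (fun i => (htraj i).eps_nonneg) hε' hδl
  obtain ⟨q, hq, hθl⟩ := hΦ.isCompact.exists_tendsto_ultrafilter l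
    (f := fun i => θ i (T i)) (.of_forall fun i => (hres i).mem_right _ (hTT i))
  obtain ⟨a, -, hwl⟩ := (isCompact_closedBall (0 : E) (ε + 1 + C)).exists_tendsto_ultrafilter
    l (f := fun i => w i (T i)) (.of_forall fun i => by simpa using hnorm i _ (hTT i))
  obtain ⟨-, -, β, hβ, hβW⟩ := hS q hq
  have hzero : Metric.infDist a (O q) ≤ 0 := by
    -- With bounded exit times the limit starts in `O q`. Otherwise the exit times exceed every `N`
    -- along the ultrafilter, and only the last `N` units of time before exit are used.
    by_cases hN : ∃ N, ∀ᶠ i in l, T i ≤ N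
    · obtain ⟨N, hN⟩ := hN
      obtain ⟨T', hT', hTl⟩ := isCompact_Icc.exists_tendsto_ultrafilter l (f := T)
        (K := Icc 0 N) (hN.mono fun i hi => ⟨(hT i).1, hi⟩)
      have hθ0 : Tendsto (fun i => θ i 0) l (𝓝 q) :=
        SlowTrajectory.tendsto_parameter (s := fun _ => 0) (t := T) (N := N)
          (.of_forall hres) hεl (.of_forall fun i => ⟨le_rfl, (hT i).1⟩) (.of_forall hTT)
          (hN.mono fun i hi => by simpa [abs_of_nonneg (hT i).1] using hi) hθl
      obtain ⟨W, M, hW1, hW2, hW3, hW4, hW5⟩ := SlowTrajectory.exists_limit hΦ hq hεl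
        hTl hθ0 (.of_forall hres) (.of_forall hnorm)
      have h1 := hβW W M T' hT'.1 hW1 hW2 hW3
      have h2 : Metric.infDist (W 0, q) (fiberedSet Q O) ≤ 0 :=
        le_of_tendsto_of_tendsto' (tendsto_infDist_fiberedSet hW4 hθ0) hδl hD0
      have h3 : (W 0, q) ∈ fiberedSet Q O := by
        obtain ⟨p, hp⟩ := (hS q hq).2.1
        exact (hO.isClosed.mem_iff_infDist_zero ⟨(p, q), hq, hp⟩).2
          (le_antisymm h2 Metric.infDist_nonneg)
      rw [Metric.infDist_zero_of_mem h3.2, hβ.zero_left hT'.1] at h1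
      rwa [tendsto_nhds_unique hwl hW5]
    · have hβR : ∀ N ≥ 0, Metric.infDist a (O q) ≤ β (ε + 1 + C + C) N := by
        intro N hN0
        have hNT : ∀ᶠ i in l, N < T i := by
          simpa using Ultrafilter.eventually_not.2 fun h => hN ⟨N, h⟩
        have hshift : ∀ᶠ i in l, SlowTrajectory Φ U Q (ε' i) N (fun t => w i (T i - N + t))
            (fun t => θ i (T i - N + t)) := hNT.mono fun i hi =>
          (hres i).shift (by linarith) hN0 (by linarith)
        have hθ0 : Tendsto (fun i => θ i (T i - N + 0)) l (𝓝 q) :=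
          SlowTrajectory.tendsto_parameter (s := fun i => T i - N + 0) (t := T) (N := N)
            (.of_forall hres) hεl (hNT.mono fun i hi => ⟨by linarith, by linarith⟩)
            (.of_forall hTT) (.of_forall fun i => by simp [abs_of_nonneg hN0]) hθl
        have hR : ∀ᶠ i in l, ∀ t ∈ Icc 0 N, ‖w i (T i - N + t)‖ ≤ ε + 1 + C :=
          hNT.mono fun i hi t ht => hnorm i _ ⟨by linarith [ht.1], by linarith [ht.2]⟩
        obtain ⟨W, M, hW1, hW2, hW3, hW4, hW5⟩ := SlowTrajectory.exists_limit hΦ hq hεl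
          (tendsto_const_nhds (x := N)) hθ0 hshift hR
        simp only [sub_add_cancel] at hW5
        have h1 := hβW W M N hN0 hW1 hW2 hW3
        rw [tendsto_nhds_unique hwl hW5]
        have h2 : ‖W 0‖ ≤ ε + 1 + C :=
          le_of_tendsto hW4.norm (hR.mono fun i hi => hi 0 ⟨le_rfl, hN0⟩)
        have h3 : Metric.infDist (W 0) (O q) ≤ ε + 1 + C + C := by
          linarith [(hC (W 0) q hq).2.2.1]
        exact h1.trans (hβ.mono N hN0 Metric.infDist_nonneg (Metric.infDist_nonneg.trans h3) h3)
      refine ge_of_tendsto (hβ.tendsto_snd (ε + 1 + C + C) (by linarith)) ?_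
      filter_upwards [eventually_ge_atTop 0] with N hN0 using hβR N hN0
  have h1 : ε ≤ Metric.infDist (a, q) (fiberedSet Q O) :=
    ge_of_tendsto' (tendsto_infDist_fiberedSet hwl hθl) fun i => (hDT i).le
  linarith [(hC a q hq).2.2.2]

/-- Up to the fixed time `T₀` the parameter stays close to its initial value, so the trajectory
follows a frozen solution, which by then is `δ`-close to `O q`. Practical stability takes over from
`T₀` on. -/
theorem FrozenStable.practically_attractive (hS : FrozenStable Φ U Q O)
    (hΦ : RegularInclusion Φ U Q) (hO : IsCompact (fiberedSet Q O)) (R : ℝ) {ε : ℝ}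
    (hε : 0 < ε) :
    ∃ M > 0, ∀ (ε' b : ℝ) (w : ℝ → E) (θ : ℝ → P), ε' ≤ 1 / M →
      SlowTrajectory Φ U Q ε' b w θ → ‖w 0‖ ≤ R →
      Metric.infDist (w b, θ b) (fiberedSet Q O) ≤ M ∧
        (M ≤ b → Metric.infDist (w b, θ b) (fiberedSet Q O) ≤ ε) := by
  obtain ⟨C, hC0, hC⟩ := exists_norm_bounds hO hS
  obtain ⟨δ, hδ, hstab⟩ := hS.practically_stable hΦ hO hε
  by_contra! hcon
  choose ε' b w θ hε' htraj hR hbad using fun i : ℕ => hcon ((i : ℝ) + 1) (by positivity)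
  have h0b : ∀ i, (0 : ℝ) ∈ Icc 0 (b i) := fun i => ⟨le_rfl, (htraj i).nonneg⟩
  have hbb : ∀ i, b i ∈ Icc 0 (b i) := fun i => ⟨(htraj i).nonneg, le_rfl⟩
  have hR0 : 0 ≤ R := (norm_nonneg _).trans (hR 0)
  set l := hyperfilter ℕ with hl
  have hεl : Tendsto ε' l (𝓝 0) := squeeze_zero (fun i => (htraj i).eps_nonneg) hε'
    ((tendsto_one_div_add_atTop_nhds_zero_nat (𝕜 := ℝ)).mono_left Nat.hyperfilter_le_atTop)
  have hlarge : ∀ K : ℝ, ∀ᶠ i : ℕ in l, K < (i : ℝ) + 1 := fun K =>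
    Nat.hyperfilter_le_atTop ((tendsto_natCast_atTop_atTop (R := ℝ)).eventually_gt_atTop K |>.mono
      fun i hi => hi.trans (lt_add_one _))
  obtain ⟨q, hq, hθ0⟩ := hΦ.isCompact.exists_tendsto_ultrafilter l (f := fun i => θ i 0)
    (.of_forall fun i => (htraj i).mem_right _ (h0b i))
  obtain ⟨-, -, β, hβ, hβW⟩ := hS q hq
  have hRC : 0 ≤ R + C := by linarith
  obtain ⟨T₀, hT₀, hT₀0⟩ := (((hβ.tendsto_snd (R + C) hRC).eventually
    (gt_mem_nhds hδ)).and (eventually_ge_atTop 0)).exists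
  -- Strictly above both the frozen bound `β (R + C) 0` and the initial distance `R + C`, so that
  -- the limit of trajectories exiting level `M₀` contradicts the frozen bound.
  set M₀ := β (R + C) 0 + (R + C) + 1 with hM₀
  have hβ0 := hβ.nonneg (R + C) 0 hRC le_rfl
  have hg0 : ∀ i, Metric.infDist (w i 0) (O q) ≤ R + C := fun i => by
    linarith [(hC (w i 0) q hq).2.2.1, hR i]
  have hlim0 : ∀ a : E, Tendsto (fun i => w i 0) l (𝓝 a) → Metric.infDist a (O q) ≤ R + C :=
    fun a ha => le_of_tendsto' (((Metric.continuous_infDist_pt (O q)).tendsto a).comp ha) hg0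
  have hbound : ∀ᶠ i in l, ∀ t ∈ Icc 0 (b i), t ≤ T₀ → Metric.infDist (w i t) (O q) ≤ M₀ := by
    by_contra hnot
    have hnot' := Ultrafilter.eventually_not.2 hnot
    -- Stated as an implication so that exit times can be chosen for all `i`, although the bound
    -- fails only along the ultrafilter.
    have hexit : ∀ i, ∃ t, (¬ ∀ t ∈ Icc 0 (b i), t ≤ T₀ → Metric.infDist (w i t) (O q) ≤ M₀) →
        t ∈ Icc 0 (b i) ∧ t ≤ T₀ ∧ M₀ < Metric.infDist (w i t) (O q) ∧
          ∀ s ∈ Icc 0 t, Metric.infDist (w i s) (O q) ≤ M₀ + 1 := by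
      intro i
      by_cases hi : ∀ t ∈ Icc 0 (b i), t ≤ T₀ → Metric.infDist (w i t) (O q) ≤ M₀
      · exact ⟨0, fun h => absurd hi h⟩
      push Not at hi
      obtain ⟨t, ht, htT, hgt⟩ := hi
      obtain ⟨R', hR'⟩ := (htraj i).bounded
      obtain ⟨M, hM0, hM⟩ := hΦ.exists_bound R'
      obtain ⟨t', ht', h1, h2⟩ := exists_first_exit (g := fun t => Metric.infDist (w i t) (O q))
        (L := M) ht.1 (fun s hs r hr hsr => by
          have h3 := (htraj i).dist_le hM hR' r ⟨hr.1, hr.2.trans ht.2⟩ s ⟨hs.1, hs.2.trans ht.2⟩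
          rw [abs_of_nonneg (sub_nonneg.2 hsr)] at h3
          linarith [Metric.infDist_le_infDist_add_dist (s := O q) (x := w i r) (y := w i s)])
        (by linarith [hg0 i]) hgt
      exact ⟨t', fun _ => ⟨⟨ht'.1, ht'.2.trans ht.2⟩, ht'.2.trans htT, h1, h2⟩⟩
    choose T hT using hexit
    have hT' := hnot'.mono hT
    obtain ⟨T', hT'mem, hTl⟩ := isCompact_Icc.exists_tendsto_ultrafilter l (f := T)
      (K := Icc 0 T₀) (hT'.mono fun i hi => ⟨hi.1.1, hi.2.1⟩)
    obtain ⟨W, M, hW1, hW2, hW3, hW4, hW5⟩ := SlowTrajectory.exists_limit (R := M₀ + 1 + C) hΦ hq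
      hεl hTl hθ0
      (hT'.mono fun i hi => (htraj i).restrict hi.1.1 hi.1.2)
      (hT'.mono fun i hi t ht => by
        linarith [(hC (w i t) q hq).2.1, hi.2.2.2 t ht])
    have h1 := hβW W M T' hT'mem.1 hW1 hW2 hW3
    have h2 := hβ.mono T' hT'mem.1 Metric.infDist_nonneg hRC (hlim0 _ hW4)
    have h3 := hβ.anti (R + C) hRC self_mem_Ici hT'mem.1 hT'mem.1
    have h4 : M₀ ≤ Metric.infDist (W T') (O q) :=
      ge_of_tendsto (((Metric.continuous_infDist_pt (O q)).tendsto _).comp hW5)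
        (hT'.mono fun i hi => hi.2.2.1.le)
    simp only at h2 h3
    linarith
  -- If `T₀ ≤ b i`, the second claimed bound holds. If `b i < T₀`, then `hbound` gives the first
  -- one, and the second is vacuous once `i + 1 > T₀`.
  rcases l.em (fun i => T₀ ≤ b i) with hcase | hcase
  · have hTmem : ∀ᶠ i in l, T₀ ∈ Icc 0 (b i) := hcase.mono fun i hi => ⟨hT₀0, hi⟩
    obtain ⟨W, M, hW1, hW2, hW3, hW4, hW5⟩ := SlowTrajectory.exists_limit (R := M₀ + C) hΦ hq
      hεl (tendsto_const_nhds (x := T₀)) hθ0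
      (hcase.mono fun i hi => (htraj i).restrict hT₀0 hi)
      (by
        filter_upwards [hbound, hcase] with i h1 h2 t ht
        linarith [(hC (w i t) q hq).2.1, h1 t ⟨ht.1, ht.2.trans h2⟩ ht.2])
    have h1 := hβW W M T₀ hT₀0 hW1 hW2 hW3
    have h2 := hβ.mono T₀ hT₀0 Metric.infDist_nonneg hRC (hlim0 _ hW4)
    simp only at h2
    have hθT : Tendsto (fun i => θ i T₀) l (𝓝 q) :=
      SlowTrajectory.tendsto_parameter (s := fun _ => T₀) (t := fun _ => 0) (N := T₀)
        (.of_forall htraj) hεl hTmem (.of_forall h0b)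
        (.of_forall fun i => by simp [abs_of_nonneg hT₀0]) hθ0
    have h3 : ∀ᶠ i in l, Metric.infDist (w i T₀, θ i T₀) (fiberedSet Q O) < δ :=
      (tendsto_infDist_fiberedSet hW5 hθT).eventually
        (gt_mem_nhds (by linarith [(hC (W T₀) q hq).2.2.2]))
    obtain ⟨i, h4, h5, h6, h7⟩ := (hcase.and (h3.and
      ((hεl.eventually (gt_mem_nhds hδ)).and (hlarge ε)))).exists
    have h8 := hstab _ _ _ _ h6.le ((htraj i).shift hT₀0 (sub_nonneg.2 h4) (by linarith))
      (by simpa using h5.le)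
    simp only [add_sub_cancel] at h8
    exact absurd h8 (not_le.2 (hbad i (h8.trans h7.le)).2)
  · have hθb : Tendsto (fun i => θ i (b i)) l (𝓝 q) :=
      SlowTrajectory.tendsto_parameter (s := b) (t := fun _ => 0) (N := T₀)
        (.of_forall htraj) hεl (.of_forall hbb) (.of_forall h0b)
        (hcase.mono fun i hi => by
          simpa [abs_of_nonneg (htraj i).nonneg] using (not_le.1 hi).le) hθ0
    obtain ⟨i, h1, h2, h3, h4, h5⟩ := (hcase.and (hbound.and
      (((Metric.tendsto_nhds.1 hθb) 1 one_pos).and ((hlarge T₀).and (hlarge (M₀ + 1)))))).exists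
    have h6 := h2 (b i) (hbb i) (not_le.1 h1).le
    have h7 := infDist_fiberedSet_le (Q := Q) (O := O) (w i (b i)) (w i (b i)) (θ i (b i)) q
    rw [dist_self] at h7
    have h8 := hbad i (by linarith [(hC (w i (b i)) q hq).2.2.2])
    linarith [h8.1]

end SlowlyVaryingParameters

/-! ### From hybrid solutions to slowly varying trajectories -/

theorem IsHybridTimeDomain.exists_slice {E : Set (ℝ × ℕ)} (hE : IsHybridTimeDomain E) {T : ℝ}
    {i j : ℕ} (hT : (T, j) ∈ E) (hij : i ≤ j) :
    ∃ a b, (a, i) ∈ E ∧ (b, i) ∈ E ∧ ∀ t ≤ T, (t, i) ∈ E → t ∈ Icc a b := by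
  obtain ⟨k, τ, h0, hm, hτ, -, hj⟩ := hE.exists_times hT hT
  have ha : (τ i, i) ∈ E := hτ _ _ (hij.trans hj.1) le_rfl (hm i.le_succ)
  have hlow : ∀ t, (t, i) ∈ E → τ i ≤ t := by
    intro t ht
    rcases i with _ | i
    · exact h0 ▸ hE.time_nonneg ht
    · by_contra! hlt
      have := hE.level_le ht (hτ (τ (i + 1)) i (by omega) (hm i.le_succ) le_rfl) hlt
      omega
  rcases hij.lt_or_eq with hlt | rfl
  · refine ⟨τ i, τ (i + 1), ha, hτ _ _ (hij.trans hj.1) (hm i.le_succ) le_rfl,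
      fun t _ ht => ⟨hlow t ht, ?_⟩⟩
    by_contra! hlt'
    have := hE.level_le (hτ (τ (i + 1)) (i + 1) (by omega) le_rfl (hm (i + 1).le_succ)) ht hlt'
    omega
  · exact ⟨τ i, T, ha, hT, fun t htT ht => ⟨hlow t ht, htT⟩⟩

theorem HybridArc.exists_norm_bound {X : Type*} [NormedAddCommGroup X] (x : HybridArc X) {T : ℝ}
    {j : ℕ} (hT : (T, j) ∈ x.dom) :
    ∃ R, ∀ i ≤ j, ∀ t ≤ T, (t, i) ∈ x.dom → ‖x.val t i‖ ≤ R := by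
  have hslice : ∀ i, ∃ R, i ≤ j → ∀ t ≤ T, (t, i) ∈ x.dom → ‖x.val t i‖ ≤ R := by
    intro i
    by_cases hij : i ≤ j
    · obtain ⟨a, b, ha, hb, hab⟩ := x.isHybridTimeDomain.exists_slice hT hij
      rcases lt_or_ge a b with hlt | hge
      · obtain ⟨R, hR⟩ := (x.absolutelyContinuous ha hb hlt).exists_bound
        rw [uIcc_of_le hlt.le] at hR
        exact ⟨R, fun _ t ht htd => hR t (hab t ht htd)⟩
      · refine ⟨‖x.val a i‖, fun _ t ht htd => ?_⟩
        obtain ⟨h1, h2⟩ := hab t ht htd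
        rw [le_antisymm (h2.trans hge) h1]
    · exact ⟨0, fun h => absurd h hij⟩
  choose R hR using hslice
  refine ⟨∑ i ∈ Finset.range (j + 1), |R i|, fun i hi t ht htd => ?_⟩
  calc ‖x.val t i‖ ≤ R i := hR i hi t ht htd
    _ ≤ |R i| := le_abs_self _
    _ ≤ _ := Finset.single_le_sum (f := fun i => |R i|) (fun _ _ => abs_nonneg _)
      (Finset.mem_range.2 (Nat.lt_succ_of_le hi))

section SlowlyVaryingSystem

variable {n m : ℕ} {U : Set (Euc n)} {Q : Set (Euc m)} {J : Euc m → Euc n → ℝ}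
  {f : Euc n → Euc n → Euc m → Set (Euc n)} {η₁ N₀ η : ℝ}
  {x : HybridArc (EProd (Euc n) (EProd (Euc m) ℝ))}

theorem isClosed_slowlyVarying_flowSet (hU : IsClosed U) (hQ : IsClosed Q) :
    IsClosed (slowlyVarying U Q f η₁ N₀).C := by
  have h1 : Continuous fun x : EProd (Euc n) (EProd (Euc m) ℝ) => x.snd :=
    WithLp.continuous_snd 2 _ _
  exact (hU.preimage (WithLp.continuous_fst 2 _ _)).inter
    ((hQ.preimage ((WithLp.continuous_fst 2 _ _).comp h1)).inter
      (isClosed_Icc.preimage ((WithLp.continuous_snd 2 _ _).comp h1)))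

theorem slowlyVarying_jumpSet_subset :
    (slowlyVarying U Q f η₁ N₀).D ⊆ (slowlyVarying U Q f η₁ N₀).C :=
  fun _ hx => ⟨hx.1, hx.2.1, zero_le_one.trans hx.2.2.1, hx.2.2.2⟩

/-- Even where a jump takes `q` out of `Q`, the timer comes from `[1, N₀]` and so lands in `[0, N₀ -
1]`. -/
theorem slowlyVarying_timer_mem (hU : IsClosed U) (hQ : IsClosed Q)
    (hx : ((slowlyVarying U Q f η₁ N₀).target (fun z => J z.fst) η).IsSolution x)
    {t : ℝ} {j : ℕ} (ht : (t, j) ∈ x.dom) : (x.val t j).snd.snd ∈ Icc 0 N₀ := by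
  rcases hx.mem_flowSet_or (isClosed_slowlyVarying_flowSet (f := f) (η₁ := η₁) hU hQ)
    (slowlyVarying_jumpSet_subset (f := f) (η₁ := η₁)) ht with h | ⟨i, rfl, h1, -⟩
  · exact h.2.2
  · obtain ⟨hD, -, -, hτ⟩ := hx.jump t i h1 ht
    rw [hτ]
    exact ⟨by linarith [hD.2.2.1], by linarith [hD.2.2.2]⟩

/-- Timer balance: each jump costs one unit, flow supplies at most `η₁` per unit of time, and the
stored amount lies in `[0, N₀]`. -/
theorem slowlyVarying_jumps_le (hU : IsClosed U) (hQ : IsClosed Q)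
    (hx : ((slowlyVarying U Q f η₁ N₀).target (fun z => J z.fst) η).IsSolution x)
    {s t : ℝ} {i j : ℕ} (hs : (s, i) ∈ x.dom) (ht : (t, j) ∈ x.dom) (hst : s ≤ t) (hij : i ≤ j) :
    (j : ℝ) - i ≤ η₁ * (t - s) + N₀ := by
  have h := x.isHybridTimeDomain.sub_le (fun t j => (x.val t j).snd.snd) (a := η₁) (b := -1)
    (fun k s' t' _ h2 _ h4 h5 => hx.flow_sub_le ((WithLp.sndL 2 ℝ (Euc m) ℝ).comp
      (WithLp.sndL 2 ℝ (Euc n) (EProd (Euc m) ℝ))) h4 h5 h2 fun r _ _ v hv => hv.2.2.2)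
    (fun r k _ _ h3 h4 => by
      obtain ⟨-, -, -, hτ⟩ := hx.jump r k h3 h4
      simp only [hτ]
      linarith) hs ht hst hij
  have h1 := (slowlyVarying_timer_mem hU hQ hx hs).2
  have h2 := (slowlyVarying_timer_mem hU hQ hx ht).1
  linarith

theorem slowlyVarying_dist_parameter_le (hη : 0 < η) (hU : IsClosed U) (hQ : IsClosed Q)
    (hx : ((slowlyVarying U Q f η₁ N₀).target (fun z => J z.fst) η).IsSolution x)
    {s t : ℝ} {i j : ℕ} (hs : (s, i) ∈ x.dom) (ht : (t, j) ∈ x.dom) (hst : s ≤ t) (hij : i ≤ j) :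
    dist (x.val s i).snd.fst (x.val t j).snd.fst ≤ η * ((1 + η₁) * (t - s) + N₀) := by
  obtain ⟨ℓ, hℓ, hval⟩ := exists_dual_vector'' ℝ ((x.val t j).snd.fst - (x.val s i).snd.fst)
  have hle : ∀ v : Euc m, ‖v‖ ≤ η → ℓ v ≤ η := fun v hv =>
    calc ℓ v ≤ ‖ℓ v‖ := Real.le_norm_self _
      _ ≤ ‖ℓ‖ * ‖v‖ := ℓ.le_opNorm v
      _ ≤ 1 * η := by gcongr
      _ = η := one_mul η
  have h := x.isHybridTimeDomain.sub_le (fun t j => ℓ (x.val t j).snd.fst) (a := η) (b := η)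
    (fun k s' t' _ h2 _ h4 h5 => hx.flow_sub_le (ℓ.comp ((WithLp.fstL 2 ℝ (Euc m) ℝ).comp
      (WithLp.sndL 2 ℝ (Euc n) (EProd (Euc m) ℝ)))) h4 h5 h2
      fun r _ _ v hv => hle _ (mem_closedBall_zero_iff.1 hv.2.1))
    (fun r k _ _ h3 h4 => by
      obtain ⟨-, -, hq, -⟩ := hx.jump r k h3 h4
      rw [← map_sub]
      exact hle _ (mem_closedBall_iff_norm.1 hq)) hs ht hst hij
  have hj := slowlyVarying_jumps_le hU hQ hx hs ht hst hij
  rw [← map_sub, hval] at h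
  rw [dist_comm, dist_eq_norm]
  have h' : ‖(x.val t j).snd.fst - (x.val s i).snd.fst‖ ≤ η * (t - s) + η * (j - i) := h
  nlinarith

/-- Jumps contribute nothing because they fix `û`. The slice endpoints `s'` and `t'` in the
hypothesis record that `r` is interior to its slice. -/
theorem slowlyVarying_functional_sub_le
    (hx : ((slowlyVarying U Q f η₁ N₀).target (fun z => J z.fst) η).IsSolution x)
    (ℓ : Euc n →L[ℝ] ℝ) {c s t : ℝ} {i j : ℕ} (hs : (s, i) ∈ x.dom) (ht : (t, j) ∈ x.dom)
    (hst : s ≤ t) (hij : i ≤ j)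
    (h : ∀ r k s' t', s ≤ s' → t' ≤ t → (s', k) ∈ x.dom → (t', k) ∈ x.dom → r ∈ Ioo s' t' →
      ∀ v ∈ f (x.val r k).fst (gradient (J (x.val r k).snd.fst) (x.val r k).fst)
        (x.val r k).snd.fst, ℓ v ≤ c) :
    ℓ (x.val t j).fst - ℓ (x.val s i).fst ≤ c * (t - s) := by
  have h := x.isHybridTimeDomain.sub_le (fun t j => ℓ (x.val t j).fst) (a := c) (b := 0)
    (fun k s' t' h1 h2 h3 h4 h5 => hx.flow_sub_le
      (ℓ.comp (WithLp.fstL 2 ℝ (Euc n) (EProd (Euc m) ℝ))) h4 h5 h2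
      fun r hr _ v hv => h r k s' t' h1 h3 h4 h5 hr _ hv.1)
    (fun r k _ _ h3 h4 => by
      obtain ⟨-, hu, -, -⟩ := hx.jump r k h3 h4
      simp only [hu, sub_self, le_refl]) hs ht hst hij
  simpa using h

theorem slowlyVarying_fst_eq
    (hx : ((slowlyVarying U Q f η₁ N₀).target (fun z => J z.fst) η).IsSolution x)
    {t : ℝ} {i j : ℕ} (hi : (t, i) ∈ x.dom) (hj : (t, j) ∈ x.dom) :
    (x.val t i).fst = (x.val t j).fst := by
  wlog hij : i ≤ j generalizing i j
  · exact (this hj hi (le_of_not_ge hij)).symm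
  obtain ⟨ℓ, -, hval⟩ := exists_dual_vector'' ℝ ((x.val t j).fst - (x.val t i).fst)
  have := slowlyVarying_functional_sub_le hx ℓ (c := 0) hi hj le_rfl hij
    fun r k s' t' h1 h2 _ _ hr => absurd (hr.1.trans hr.2) (not_lt.2 (h2.trans h1))
  rw [← map_sub, hval, zero_mul] at this
  exact (sub_eq_zero.1 (norm_le_zero_iff.1 this)).symm

/-- The `û`-component of a solution, as a function of ordinary time, is a trajectory of the
inclusion with slowly varying parameter. -/
theorem exists_slowTrajectory (hη : 0 < η) (hη₁ : 0 < η₁) (hN₀ : 1 ≤ N₀) (hU : IsClosed U)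
    (hQ : IsClosed Q)
    (hx : ((slowlyVarying U Q f η₁ N₀).target (fun z => J z.fst) η).IsSolution x)
    {T : ℝ} {j : ℕ} (hT : (T, j) ∈ x.dom) :
    ∃ (w : ℝ → Euc n) (θ : ℝ → Euc m),
      SlowTrajectory (fun u q => f u (gradient (J q) u) q) U Q (η * (1 + η₁ + N₀)) T w θ ∧
      w 0 = (x.val 0 0).fst ∧ θ 0 = (x.val 0 0).snd.fst ∧ w T = (x.val T j).fst ∧
      dist (θ T) (x.val T j).snd.fst ≤ η * (1 + η₁ + N₀) := by
  have hE := x.isHybridTimeDomain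
  have hC := isClosed_slowlyVarying_flowSet (f := f) (η₁ := η₁) (N₀ := N₀) hU hQ
  have hDC := slowlyVarying_jumpSet_subset (U := U) (Q := Q) (f := f) (η₁ := η₁) (N₀ := N₀)
  have hT0 := hE.time_nonneg hT
  -- Several levels may share a time `t`. One with state in `C` is chosen, since a jump may leave
  -- `Q`; at `t = 0` it is level `0`, so that the initial data agree.
  have hlevel : ∀ t, ∃ i, t ∈ Icc 0 T → i ≤ j ∧ (t, i) ∈ x.dom ∧
      x.val t i ∈ (slowlyVarying U Q f η₁ N₀).C ∧ (t = 0 → i = 0) := by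
    intro t
    by_cases ht : t ∈ Icc 0 T
    · by_cases h0 : t = 0
      · subst h0
        exact ⟨0, fun _ => ⟨Nat.zero_le j, hE.zero_mem,
          hx.init.elim id fun h => hDC h, fun _ => rfl⟩⟩
      · obtain ⟨i, h1, h2, h3⟩ :=
          hx.exists_level_mem_flowSet hC hDC hT ht.1 ht.2
        exact ⟨i, fun _ => ⟨h1, h2, h3, fun h => absurd h h0⟩⟩
    · exact ⟨0, fun h => absurd h ht⟩
  choose ι hι using hlevel
  obtain ⟨R, hR⟩ := x.exists_norm_bound hT
  have hmono : ∀ s ∈ Icc 0 T, ∀ t ∈ Icc 0 T, s ≤ t → s = t ∨ ι s ≤ ι t := by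
    intro s hs t ht hst
    rcases hst.eq_or_lt with h | h
    · exact Or.inl h
    · exact Or.inr (hE.level_le (hι s hs).2.1 (hι t ht).2.1 h)
  have hκ : ∀ d : ℝ, 0 ≤ d → η * ((1 + η₁) * d + N₀) ≤ η * (1 + η₁ + N₀) * (1 + d) := by
    intro d hd
    rw [mul_assoc]
    refine mul_le_mul_of_nonneg_left ?_ hη.le
    nlinarith
  have hslow : ∀ s ∈ Icc 0 T, ∀ t ∈ Icc 0 T, s ≤ t →
      dist (x.val s (ι s)).snd.fst (x.val t (ι t)).snd.fst ≤
        η * (1 + η₁ + N₀) * (1 + |s - t|) := by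
    intro s hs t ht hst
    rcases hmono s hs t ht hst with rfl | h
    · rw [dist_self]
      positivity
    · rw [abs_sub_comm, abs_of_nonneg (sub_nonneg.2 hst)]
      exact (slowlyVarying_dist_parameter_le hη hU hQ hx (hι s hs).2.1 (hι t ht).2.1 hst h).trans
        (hκ _ (sub_nonneg.2 hst))
  have h0 : (0 : ℝ) ∈ Icc 0 T := ⟨le_rfl, hT0⟩
  have hTT : T ∈ Icc 0 T := ⟨hT0, le_rfl⟩
  refine ⟨fun t => (x.val t (ι t)).fst, fun t => (x.val t (ι t)).snd.fst,
    ⟨hT0, fun t ht => (hι t ht).2.2.1.1, fun t ht => (hι t ht).2.2.1.2.1,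
      ⟨R, fun t ht => (WithLp.norm_fst_le ..).trans (hR _ (hι t ht).1 t ht.2 (hι t ht).2.1)⟩,
      fun s hs t ht => ?_, fun ℓ c s hs t ht hst hv => ?_⟩, ?_, ?_, ?_, ?_⟩
  · rcases le_total s t with h | h
    · exact hslow s hs t ht h
    · rw [dist_comm, abs_sub_comm]
      exact hslow t ht s hs h
  · rcases hmono s hs t ht hst with rfl | hle
    · simp
    refine slowlyVarying_functional_sub_le hx ℓ (hι s hs).2.1 (hι t ht).2.1 hst hle ?_
    intro r k s' t' h1 h2 h3 h4 hr v hv'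
    have hrI : r ∈ Icc s t := ⟨h1.trans hr.1.le, hr.2.le.trans h2⟩
    have hrT : r ∈ Icc 0 T := ⟨hs.1.trans hrI.1, hrI.2.trans ht.2⟩
    -- Interior times of a slice belong to no other slice, so the chosen level is `k`.
    have hk : ι r = k := le_antisymm (hE.level_le (hι r hrT).2.1 h4 hr.2)
      (hE.level_le h3 (hι r hrT).2.1 hr.1)
    refine hv r hrI v ?_
    simpa only [hk] using hv'
  · simp only [(hι 0 h0).2.2.2 rfl]
  · simp only [(hι 0 h0).2.2.2 rfl]
  · exact slowlyVarying_fst_eq hx (hι T hTT).2.1 hT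
  -- The chosen level at `T` may precede `j` by instantaneous jumps, whose number the timer bounds.
  · have h := slowlyVarying_dist_parameter_le hη hU hQ hx (hι T hTT).2.1 hT le_rfl (hι T hTT).1
    have h' := hκ 0 le_rfl
    rw [sub_self] at h
    linarith

end SlowlyVaryingSystem

/-! ### Regularity of the data -/

section RegularData

variable {n m : ℕ} {U : Set (Euc n)} {Q : Set (Euc m)}
  {f : Euc n → Euc n → Euc m → Set (Euc n)}

theorem continuous_toLp_zero {X Y : Type*} [NormedAddCommGroup X] [NormedAddCommGroup Y] :
    Continuous fun v : X => (WithLp.toLp 2 (v, 0) : EProd X Y) :=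
  (WithLp.prod_continuous_toLp 2 _ _).comp (by fun_prop)

/-- Regularity of the flow map `f` itself, extracted from that of the freely switching dynamics. -/
structure RegularFlowMap (U : Set (Euc n)) (Q : Set (Euc m))
    (f : Euc n → Euc n → Euc m → Set (Euc n)) : Prop where
  convex : ∀ u ∈ U, ∀ ξ, ∀ q ∈ Q, Convex ℝ (f u ξ q)
  osc : ∀ u ∈ U, ∀ ξ, ∀ q ∈ Q, ∀ (us : ℕ → Euc n) (ξs : ℕ → Euc n) (qs : ℕ → Euc m)
    (vs : ℕ → Euc n) (v : Euc n), (∀ i, us i ∈ U) → (∀ i, qs i ∈ Q) →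
    (∀ i, vs i ∈ f (us i) (ξs i) (qs i)) → Tendsto us atTop (𝓝 u) → Tendsto ξs atTop (𝓝 ξ) →
    Tendsto qs atTop (𝓝 q) → Tendsto vs atTop (𝓝 v) → v ∈ f u ξ q
  lb : ∀ u ∈ U, ∀ ξ, ∀ q ∈ Q, ∃ M : ℝ, ∀ᶠ p : Euc n × Euc n × Euc m in 𝓝 (u, ξ, q),
    p.1 ∈ U → p.2.2 ∈ Q → ∀ v ∈ f p.1 p.2.1 p.2.2, ‖v‖ ≤ M

theorem DecisionDynamics.RegularData.regularFlowMap
    (hf : (freeSwitching U Q f).RegularData U) : RegularFlowMap U Q f := by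
  obtain ⟨δ, hδ, h⟩ := hf
  obtain ⟨-, hosc, hlb, hconv, -, -⟩ := h δ ⟨hδ, le_rfl⟩
  refine ⟨fun u hu ξ q hq v hv v' hv' a b ha hb hab => ?_, ?_, ?_⟩
  · have h1 := @hconv (WithLp.toLp 2 (u, q)) ⟨hu, hq⟩ ξ (WithLp.toLp 2 (v, 0)) ⟨hv, rfl⟩
      (WithLp.toLp 2 (v', 0)) ⟨hv', rfl⟩ a b ha hb hab
    exact h1.1
  · intro u hu ξ q hq us ξs qs vs v hus hqs hvs hul hξl hql hvl
    have h1 := hosc (WithLp.toLp 2 (u, q), ξ) ⟨⟨hu, hq⟩, mem_univ _⟩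
      (fun i => (WithLp.toLp 2 (us i, qs i), ξs i)) (fun i => WithLp.toLp 2 (vs i, 0))
      (WithLp.toLp 2 (v, 0)) (fun i => ⟨⟨hus i, hqs i⟩, mem_univ _⟩) (fun i => ⟨hvs i, rfl⟩)
      ((((WithLp.prod_continuous_toLp 2 _ _).tendsto _).comp (hul.prodMk_nhds hql)).prodMk_nhds
        hξl) ((continuous_toLp_zero.tendsto _).comp hvl)
    exact h1.1
  · intro u hu ξ q hq
    obtain ⟨N, hN, hmem, hbd⟩ := hlb (WithLp.toLp 2 (u, q), ξ) ⟨⟨hu, hq⟩, mem_univ _⟩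
    obtain ⟨M, hM⟩ := hbd.exists_norm_le
    have hcont : Continuous fun p : Euc n × Euc n × Euc m =>
        ((WithLp.toLp 2 (p.1, p.2.2) : EProd (Euc n) (Euc m)), p.2.1) :=
      ((WithLp.prod_continuous_toLp 2 _ _).comp (by fun_prop)).prodMk (by fun_prop)
    refine ⟨M, ?_⟩
    filter_upwards [(hN.preimage hcont).mem_nhds hmem] with p hp hpU hpQ v hv
    have h1 := hM (WithLp.toLp 2 (v, 0)) (mem_biUnion ⟨hp, ⟨hpU, hpQ⟩, mem_univ _⟩ ⟨hv, rfl⟩)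
    exact (WithLp.norm_fst_le ..).trans h1

/-- `U` is a slice of the closed set `U × Q`; an empty `Q` would give no information on `U`. -/
theorem DecisionDynamics.RegularData.isClosed
    (hf : (freeSwitching U Q f).RegularData U) (hQ : Q.Nonempty) : IsClosed U := by
  obtain ⟨δ, hδ, h⟩ := hf
  obtain ⟨q, hq⟩ := hQ
  have hcont : Continuous fun u : Euc n => (WithLp.toLp 2 (u, q) : EProd (Euc n) (Euc m)) :=
    (WithLp.prod_continuous_toLp 2 _ _).comp (by fun_prop)
  convert (h δ ⟨hδ, le_rfl⟩).1.1.preimage hcont using 1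
  ext u
  exact ⟨fun hu => ⟨hu, hq⟩, fun hu => hu.1⟩

theorem RegularFlowMap.regularInclusion (h : RegularFlowMap U Q f) (hU : IsClosed U)
    (hQ : IsCompact Q) {J : Euc m → Euc n → ℝ}
    (hJ : ContinuousOn (fun p : Euc m × Euc n => gradient (J p.1) p.2) (Q ×ˢ U)) :
    RegularInclusion (fun u q => f u (gradient (J q) u) q) U Q := by
  have hJ' : ContinuousOn (fun p : Euc n × Euc m => gradient (J p.2) p.1) (U ×ˢ Q) :=
    hJ.comp continuous_swap.continuousOn fun p hp => ⟨hp.2, hp.1⟩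
  refine ⟨hU, hQ, fun u hu q hq => h.convex u hu _ q hq, ?_, ?_⟩
  · intro z hz zs ss s hzs hss hzl hsl
    have hgrad : Tendsto (fun i => gradient (J (zs i).2) (zs i).1) atTop
        (𝓝 (gradient (J z.2) z.1)) :=
      (hJ' z hz).tendsto.comp (tendsto_nhdsWithin_iff.2 ⟨hzl, .of_forall hzs⟩)
    exact h.osc z.1 hz.1 _ z.2 hz.2 (fun i => (zs i).1) _ (fun i => (zs i).2) ss s
      (fun i => (hzs i).1) (fun i => (hzs i).2) hss ((continuous_fst.tendsto _).comp hzl) hgrad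
      ((continuous_snd.tendsto _).comp hzl) hsl
  · intro z hz
    obtain ⟨M, hM⟩ := h.lb z.1 hz.1 (gradient (J z.2) z.1) z.2 hz.2
    have hlim : Tendsto (fun p : Euc n × Euc m => (p.1, gradient (J p.2) p.1, p.2))
        (𝓝[U ×ˢ Q] z) (𝓝 (z.1, gradient (J z.2) z.1, z.2)) :=
      (continuous_fst.continuousWithinAt.tendsto).prodMk_nhds
        ((hJ' z hz).tendsto.prodMk_nhds continuous_snd.continuousWithinAt.tendsto)
    obtain ⟨N, hN, hzN, hsub⟩ := mem_nhdsWithin.1 (hlim.eventually hM)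
    refine ⟨N, hN, hzN, (Metric.isBounded_closedBall (x := (0 : Euc n)) (r := M)).subset ?_⟩
    refine iUnion₂_subset fun p hp v hv => ?_
    rw [mem_closedBall_zero_iff]
    exact hsub hp hp.2.1 hp.2.2 v hv

theorem RegularFlowMap.regularData_slowlyVarying (h : RegularFlowMap U Q f) (hQ : IsCompact Q)
    (hU : Q.Nonempty → IsClosed U) (η₁ N₀ : ℝ) :
    (slowlyVarying U Q f η₁ N₀).RegularData U := by
  have hs : Continuous fun x : EProd (Euc n) (EProd (Euc m) ℝ) => x.snd :=
    WithLp.continuous_snd 2 _ _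
  have hu : Continuous fun x : EProd (Euc n) (EProd (Euc m) ℝ) => x.fst :=
    WithLp.continuous_fst 2 _ _
  have hq : Continuous fun x : EProd (Euc n) (EProd (Euc m) ℝ) => x.snd.fst :=
    (WithLp.continuous_fst 2 _ _).comp hs
  have hτ : Continuous fun x : EProd (Euc n) (EProd (Euc m) ℝ) => x.snd.snd :=
    (WithLp.continuous_snd 2 _ _).comp hs
  have hclosed : ∀ a b : ℝ, IsClosed {x : EProd (Euc n) (EProd (Euc m) ℝ) |
      x.fst ∈ U ∧ x.snd.fst ∈ Q ∧ x.snd.snd ∈ Icc a b} := by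
    intro a b
    rcases Q.eq_empty_or_nonempty with hE | hE
    · simp [hE]
    · exact ((hU hE).preimage hu).inter ((hQ.isClosed.preimage hq).inter
        (isClosed_Icc.preimage hτ))
  have hnorm : ∀ {v : EProd (Euc n) (EProd (Euc m) ℝ)} {a b c : ℝ}, ‖v.fst‖ ≤ a →
      ‖v.snd.fst‖ ≤ b → |v.snd.snd| ≤ c → ‖v‖ ≤ a + (b + c) := by
    intro v a b c h1 h2 h3
    have key : ∀ {X Y : Type} [NormedAddCommGroup X] [NormedAddCommGroup Y] (v : EProd X Y),
        ‖v‖ ≤ ‖v.fst‖ + ‖v.snd‖ := by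
      intro X Y _ _ v
      rw [WithLp.prod_norm_eq_of_L2]
      exact Real.sqrt_le_iff.2 ⟨by positivity, by nlinarith [norm_nonneg v.fst, norm_nonneg v.snd]⟩
    have h4 := key v
    have h5 := key v.snd
    rw [Real.norm_eq_abs] at h5
    linarith
  refine ⟨1, one_pos, fun δ hδ => ⟨⟨hclosed 0 N₀, hclosed 1 N₀, ?_, ?_⟩, ?_, ?_, ?_, ?_, ?_⟩⟩
  · rintro _ ⟨x, hx, rfl⟩
    exact hx.1
  · rintro _ ⟨x, hx, rfl⟩
    exact hx.1
  · intro z hz zs ss s hzs hss hzl hsl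
    have hz1 := (continuous_fst.tendsto _).comp hzl
    refine ⟨h.osc z.1.fst hz.1.1 z.2 z.1.snd.fst hz.1.2.1 (fun i => (zs i).1.fst)
      (fun i => (zs i).2) (fun i => (zs i).1.snd.fst) (fun i => (ss i).fst) s.fst
      (fun i => (hzs i).1.1) (fun i => (hzs i).1.2.1) (fun i => (hss i).1)
      ((hu.tendsto _).comp hz1) ((continuous_snd.tendsto _).comp hzl) ((hq.tendsto _).comp hz1)
      ((hu.tendsto _).comp hsl), ?_, ?_⟩
    · exact Metric.isClosed_closedBall.mem_of_tendsto ((hq.tendsto _).comp hsl)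
        (.of_forall fun i => (hss i).2.1)
    · exact isClosed_Icc.mem_of_tendsto ((hτ.tendsto _).comp hsl)
        (.of_forall fun i => (hss i).2.2)
  · intro z hz
    obtain ⟨M, hM⟩ := h.lb z.1.fst hz.1.1 z.2 z.1.snd.fst hz.1.2.1
    have hcont : Continuous fun p : EProd (Euc n) (EProd (Euc m) ℝ) × Euc n =>
        (p.1.fst, p.2, p.1.snd.fst) :=
      (hu.comp continuous_fst).prodMk (continuous_snd.prodMk (hq.comp continuous_fst))
    obtain ⟨N, hsub, hN, hzN⟩ := mem_nhds_iff.1 ((hcont.tendsto z).eventually hM)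
    refine ⟨N, hN, hzN, isBounded_iff_forall_norm_le.2 ⟨M + (δ + |η₁|), ?_⟩⟩
    intro v hv
    obtain ⟨p, ⟨hpN, hpC, -⟩, hv1, hv2, hv3⟩ := mem_iUnion₂.1 hv
    refine hnorm (hsub hpN hpC.1 hpC.2.1 _ hv1) (mem_closedBall_zero_iff.1 hv2) ?_
    rw [abs_of_nonneg hv3.1]
    exact hv3.2.trans (le_abs_self _)
  · intro x hx ξ v hv v' hv' a b ha hb hab
    exact ⟨h.convex _ hx.1 ξ _ hx.2.1 hv.1 hv'.1 ha hb hab,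
      convex_closedBall (0 : Euc m) δ hv.2.1 hv'.2.1 ha hb hab,
      convex_Icc 0 η₁ hv.2.2 hv'.2.2 ha hb hab⟩
  · intro z hz zs ss s hzs hss hzl hsl
    refine ⟨tendsto_nhds_unique ((hu.tendsto _).comp hsl) ?_, ?_,
      tendsto_nhds_unique ((hτ.tendsto _).comp hsl) ?_⟩
    · exact ((hu.tendsto _).comp hzl).congr fun i => (hss i).1.symm
    · rw [Metric.mem_closedBall]
      exact le_of_tendsto' (((hq.tendsto _).comp hsl).dist ((hq.tendsto _).comp hzl))
        fun i => (hss i).2.1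
    · exact (((hτ.tendsto _).comp hzl).sub_const 1).congr fun i => (hss i).2.2.symm
  · intro z hz
    refine ⟨Metric.ball z 1, Metric.isOpen_ball, Metric.mem_ball_self one_pos,
      isBounded_iff_forall_norm_le.2
        ⟨(‖z‖ + 1) + ((‖z‖ + 1 + δ) + (‖z‖ + 1 + 1)), ?_⟩⟩
    intro v hv
    obtain ⟨p, ⟨hpN, hpD⟩, hv1, hv2, hv3⟩ := mem_iUnion₂.1 hv
    have hp : ‖p‖ ≤ ‖z‖ + 1 := by
      have h1 := Metric.mem_ball.1 hpN
      rw [dist_eq_norm] at h1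
      linarith [norm_le_norm_add_norm_sub' p z]
    have hp1 : ‖p.fst‖ ≤ ‖p‖ := WithLp.norm_fst_le ..
    have hp2 : ‖p.snd‖ ≤ ‖p‖ := WithLp.norm_snd_le ..
    have hp3 : ‖p.snd.fst‖ ≤ ‖p.snd‖ := WithLp.norm_fst_le ..
    have hp4 : ‖p.snd.snd‖ ≤ ‖p.snd‖ := WithLp.norm_snd_le ..
    refine hnorm (by rw [hv1]; linarith) ?_ ?_
    · have h2 := mem_closedBall_iff_norm.1 hv2
      linarith [norm_le_norm_add_norm_sub' v.snd.fst p.snd.fst]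
    · rw [hv3]
      rw [Real.norm_eq_abs] at hp4
      have h2 := abs_sub p.snd.snd 1
      rw [abs_one] at h2
      linarith

end RegularData

/-! ### Practical stability of the slowly varying system -/

section Main

variable {n m : ℕ} {U : Set (Euc n)} {Q : Set (Euc m)} {J : Euc m → Euc n → ℝ}
  {f : Euc n → Euc n → Euc m → Set (Euc n)} {O : Euc m → Set (Euc n)} {η₁ N₀ : ℝ}

theorem frozenStable_of_ugas (hO_ne : ∀ q ∈ Q, (O q).Nonempty)
    (hO : ∀ q ∈ Q, UGAS (frozenSystem U J f q) (O q)) :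
    FrozenStable (fun u q => f u (gradient (J q) u) q) U Q O := by
  intro q hq
  obtain ⟨hc, β, hβ, hbd⟩ := hO q hq
  exact ⟨hc, hO_ne q hq, β, hβ, fun W M T hT hW hWU hd =>
    HybridSystem.infDist_le_of_lipschitzWith (H := frozenSystem U J f q) rfl hbd hT hW
      (fun t _ => hWU t) hd⟩

theorem isCompact_fiberedSet
    (hO : IsCompact {x : EProd (Euc n) (Euc m) | x.snd ∈ Q ∧ x.fst ∈ O x.snd}) :
    IsCompact (fiberedSet Q O) := by
  convert hO.image (WithLp.prod_continuous_ofLp 2 (Euc n) (Euc m)) using 1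
  ext p
  exact ⟨fun hp => ⟨WithLp.toLp 2 p, hp, rfl⟩, by rintro ⟨x, hx, rfl⟩; exact hx⟩

/-- The set of `(û, (q, τ))` with `(û, q)` in the fibered set and `τ ∈ [0, N₀]`. -/
def timedSet (Q : Set (Euc m)) (O : Euc m → Set (Euc n)) (N₀ : ℝ) :
    Set (EProd (Euc n) (EProd (Euc m) ℝ)) :=
  {x | x.snd ∈ {z : EProd (Euc m) ℝ | z.fst ∈ Q ∧ z.snd ∈ Icc 0 N₀} ∧ x.fst ∈ O x.snd.fst}

theorem isCompact_timedSet (hO : IsCompact (fiberedSet Q O)) : IsCompact (timedSet Q O N₀) := by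
  have hcont : Continuous fun p : (Euc n × Euc m) × ℝ =>
      (WithLp.toLp 2 (p.1.1, WithLp.toLp 2 (p.1.2, p.2)) : EProd (Euc n) (EProd (Euc m) ℝ)) := by
    refine (WithLp.prod_continuous_toLp 2 _ _).comp ((by fun_prop : Continuous fun p :
      (Euc n × Euc m) × ℝ => p.1.1).prodMk ((WithLp.prod_continuous_toLp 2 _ _).comp ?_))
    fun_prop
  convert (hO.prod (isCompact_Icc (a := (0 : ℝ)) (b := N₀))).image hcont using 1
  ext x
  constructor
  · exact fun hx => ⟨((x.fst, x.snd.fst), x.snd.snd), ⟨⟨hx.1.1, hx.2⟩, hx.1.2⟩, rfl⟩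
  · rintro ⟨p, ⟨hp1, hp2⟩, rfl⟩
    exact ⟨⟨hp1.1, hp2⟩, hp1.2⟩

theorem EProd.dist_le_add {X Y : Type*} [NormedAddCommGroup X] [NormedAddCommGroup Y]
    (x y : EProd X Y) : dist x y ≤ dist x.fst y.fst + dist x.snd y.snd := by
  rw [WithLp.prod_dist_eq_of_L2]
  have h1 := dist_nonneg (x := x.fst) (y := y.fst)
  have h2 := dist_nonneg (x := x.snd) (y := y.snd)
  exact Real.sqrt_le_iff.2 ⟨by positivity, by nlinarith⟩

theorem infDist_fiberedSet_le_timedSet (hne : (timedSet Q O N₀).Nonempty)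
    (x : EProd (Euc n) (EProd (Euc m) ℝ)) :
    Metric.infDist (x.fst, x.snd.fst) (fiberedSet Q O) ≤ Metric.infDist x (timedSet Q O N₀) := by
  refine (Metric.le_infDist hne).2 fun a ha => ?_
  have hmem : (a.fst, a.snd.fst) ∈ fiberedSet Q O := ⟨ha.1.1, ha.2⟩
  refine (Metric.infDist_le_dist_of_mem hmem).trans (max_le ?_ ?_)
  · exact WithLp.dist_fst_le (x := x) (y := a)
  · exact (WithLp.dist_fst_le (x := x.snd) (y := a.snd)).trans
      (WithLp.dist_snd_le (x := x) (y := a))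

/-- The timer of `x` can be kept, so it costs no distance; the factor `2` passes from the sup metric
of `fiberedSet` to the Euclidean one. -/
theorem infDist_timedSet_le (hO : IsCompact (fiberedSet Q O)) (hne : (fiberedSet Q O).Nonempty)
    (x : EProd (Euc n) (EProd (Euc m) ℝ)) (hx : x.snd.snd ∈ Icc 0 N₀) :
    Metric.infDist x (timedSet Q O N₀) ≤
      2 * Metric.infDist (x.fst, x.snd.fst) (fiberedSet Q O) := by
  obtain ⟨p, hp, hpd⟩ := hO.exists_infDist_eq_dist hne (x.fst, x.snd.fst)
  have hmem : (WithLp.toLp 2 (p.1, WithLp.toLp 2 (p.2, x.snd.snd)) :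
      EProd (Euc n) (EProd (Euc m) ℝ)) ∈ timedSet Q O N₀ := ⟨⟨hp.1, hx⟩, hp.2⟩
  refine (Metric.infDist_le_dist_of_mem hmem).trans ?_
  have h1 := EProd.dist_le_add x (WithLp.toLp 2 (p.1, WithLp.toLp 2 (p.2, x.snd.snd)))
  have h2 := EProd.dist_le_add x.snd (WithLp.toLp 2 (p.2, x.snd.snd))
  simp only [WithLp.toLp_fst, WithLp.toLp_snd, dist_self, add_zero] at h1 h2
  have h3 : dist x.fst p.1 ≤ dist (x.fst, x.snd.fst) p := le_max_left _ _
  have h4 : dist x.snd.fst p.2 ≤ dist (x.fst, x.snd.fst) p := le_max_right _ _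
  rw [hpd]
  linarith

/-- Practical `𝒦ℒ` bounds with respect to `A` of a family of hybrid systems, from practical
stability and practical attractivity. -/
theorem sgpas_of_practical {X : Type*} [NormedAddCommGroup X] [NormedSpace ℝ X]
    {H : ℝ → HybridSystem X} {A : Set X} (hA : IsCompact A)
    (hstab : ∀ ε > 0, ∃ δ > 0, ∀ᶠ η in 𝓝[>] (0 : ℝ), ∀ x, (H η).IsSolution x →
      Metric.infDist (x.val 0 0) A ≤ δ → ∀ t j, (t, j) ∈ x.dom → Metric.infDist (x.val t j) A ≤ ε)
    (hattr : ∀ R, ∀ ε > 0, ∃ M > 0, ∀ᶠ η in 𝓝[>] (0 : ℝ), ∀ x, (H η).IsSolution x →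
      Metric.infDist (x.val 0 0) A ≤ R → ∀ (t : ℝ) (j : ℕ), (t, j) ∈ x.dom →
        Metric.infDist (x.val t j) A ≤ M ∧ (M ≤ t + j → Metric.infDist (x.val t j) A ≤ ε)) :
    SGPAS H A := by
  obtain ⟨β, hβ, h⟩ := exists_isClassKL_of_practical
    (fun η r s y => ∃ x, (H η).IsSolution x ∧ ∃ (t : ℝ) (j : ℕ), (t, j) ∈ x.dom ∧
      r = Metric.infDist (x.val 0 0) A ∧ s = t + j ∧ y = Metric.infDist (x.val t j) A)
    (fun ε hε => by
      obtain ⟨δ, hδ, h⟩ := hstab ε hε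
      refine ⟨δ, hδ, h.mono ?_⟩
      rintro η hη r hr s y ⟨x, hx, t, j, ht, rfl, rfl, rfl⟩
      exact hη x hx hr t j ht)
    (fun R ε hε => by
      obtain ⟨M, hM, h⟩ := hattr R ε hε
      refine ⟨M, hM, h.mono ?_⟩
      rintro η hη r hr s y ⟨x, hx, t, j, ht, rfl, rfl, rfl⟩
      exact hη x hx hr t j ht)
  refine ⟨hA, β, hβ, fun Δ ν hν _ => ?_⟩
  obtain ⟨ε', hε', hsub⟩ :=
    -- `SGPAS` limits the initial norm by `Δ`; the distance to `A` is then at most `Metric.infDist 0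
    -- A + Δ`.
    mem_nhdsGT_iff_exists_Ioo_subset.1 (h (Metric.infDist 0 A + Δ) ν hν)
  refine ⟨ε', hε', fun η hη x hx hΔ t j ht => ?_⟩
  refine hsub hη _ ?_ (t + j) ?_ _ Metric.infDist_nonneg ⟨x, hx.1, t, j, ht, rfl, rfl, rfl⟩
  · have := Metric.infDist_le_infDist_add_dist (s := A) (x := x.val 0 0) (y := 0)
    rw [dist_zero_right] at this
    linarith
  · have := x.isHybridTimeDomain.time_nonneg ht
    change 0 ≤ t + (j : ℝ)
    positivity

theorem sgpas_slowlyVarying (hΦ : RegularInclusion (fun u q => f u (gradient (J q) u) q) U Q)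
    (hS : FrozenStable (fun u q => f u (gradient (J q) u) q) U Q O)
    (hO : IsCompact (fiberedSet Q O)) (hQ : Q.Nonempty) (hη₁ : 0 < η₁) (hN₀ : 1 ≤ N₀) :
    SGPAS ((slowlyVarying U Q f η₁ N₀).target fun z => J z.fst) (timedSet Q O N₀) := by
  have hU := hΦ.isClosed
  have hQc := hΦ.isCompact.isClosed
  have hneO : (fiberedSet Q O).Nonempty := by
    obtain ⟨q, hq⟩ := hQ
    obtain ⟨u, hu⟩ := (hS q hq).2.1
    exact ⟨(u, q), hq, hu⟩
  have hneA : (timedSet Q O N₀).Nonempty := by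
    obtain ⟨p, hp⟩ := hneO
    exact ⟨WithLp.toLp 2 (p.1, WithLp.toLp 2 (p.2, 0)), ⟨hp.1, le_rfl, zero_le_one.trans hN₀⟩,
      hp.2⟩
  set κ : ℝ := 1 + η₁ + N₀ with hκ
  have hκ0 : 0 < κ := by linarith
  have hsmall : ∀ c > 0, ∀ᶠ η in 𝓝[>] (0 : ℝ), 0 < η ∧ η * κ ≤ c := by
    intro c hc
    filter_upwards [Ioo_mem_nhdsGT (show (0 : ℝ) < c / κ by positivity)] with η hη
    exact ⟨hη.1, ((lt_div_iff₀ hκ0).1 hη.2).le⟩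
  have hend : ∀ {η : ℝ} {x : HybridArc (EProd (Euc n) (EProd (Euc m) ℝ))} {t : ℝ} {j : ℕ}
      {w : ℝ → Euc n} {θ : ℝ → Euc m} {c : ℝ},
      ((slowlyVarying U Q f η₁ N₀).target (fun z => J z.fst) η).IsSolution x → (t, j) ∈ x.dom →
      w t = (x.val t j).fst → dist (θ t) (x.val t j).snd.fst ≤ η * κ →
      Metric.infDist (w t, θ t) (fiberedSet Q O) ≤ c →
      Metric.infDist (x.val t j) (timedSet Q O N₀) ≤ 2 * (c + η * κ) := by
    intro η x t j w θ c hx ht hw hθ hc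
    refine (infDist_timedSet_le hO hneO _ (slowlyVarying_timer_mem hU hQc hx ht)).trans ?_
    have h1 := infDist_fiberedSet_le (Q := Q) (O := O) (x.val t j).fst (w t)
      (x.val t j).snd.fst (θ t)
    rw [hw, dist_self, dist_comm, ← hw] at h1
    rw [← hw]
    linarith
  refine sgpas_of_practical (isCompact_timedSet hO) (fun ε hε => ?_) (fun R ε hε => ?_)
  · obtain ⟨δ, hδ, h⟩ := hS.practically_stable hΦ hO (show 0 < ε / 4 by linarith)
    refine ⟨δ, hδ, ?_⟩
    filter_upwards [hsmall (min δ (ε / 4)) (lt_min hδ (by linarith))] with η hη x hx h0 t j ht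
    obtain ⟨w, θ, htraj, hw0, hθ0, hwt, hθt⟩ :=
      exists_slowTrajectory hη.1 hη₁ hN₀ hU hQc hx ht
    have h1 := h _ _ _ _ (hη.2.trans (min_le_left _ _)) htraj (by
      rw [hw0, hθ0]
      exact (infDist_fiberedSet_le_timedSet hneA _).trans h0)
    have h2 := hend hx ht hwt hθt h1
    linarith [hη.2.trans (min_le_right _ _)]
  · obtain ⟨C, hC0, hC⟩ := exists_norm_bounds hO hS
    obtain ⟨M, hM, h⟩ := hS.practically_attractive hΦ hO (R + C) (show 0 < ε / 4 by linarith)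
    -- The first term bounds the distance when `η * κ ≤ 1`. The second works because `t + j ≤ (1 +
    -- η₁) * t + N₀`, so that `t + j` above it forces `t ≥ M`.
    refine ⟨max (2 * (M + 1)) ((1 + η₁) * M + N₀), lt_max_of_lt_left (by linarith), ?_⟩
    have hpos : 0 < min (1 / M) (min 1 (ε / 4)) :=
      lt_min (by positivity) (lt_min one_pos (by linarith))
    filter_upwards [hsmall _ hpos] with η hη x hx h0 t j ht
    obtain ⟨w, θ, htraj, hw0, hθ0, hwt, hθt⟩ :=
      exists_slowTrajectory hη.1 hη₁ hN₀ hU hQc hx ht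
    have hηκ := hη.2.trans (min_le_right _ _)
    have h1 := h _ _ _ _ (hη.2.trans (min_le_left _ _)) htraj (by
      have h2 := htraj.mem_right 0 ⟨le_rfl, htraj.nonneg⟩
      have h3 := (hC (w 0) (θ 0) h2).1
      rw [hw0, hθ0] at h3
      rw [hw0]
      linarith [infDist_fiberedSet_le_timedSet hneA (x.val 0 0)])
    refine ⟨?_, fun hMt => ?_⟩
    · have h2 := hend hx ht hwt hθt h1.1
      exact (h2.trans (by linarith [hηκ.trans (min_le_left _ _)])).trans (le_max_left _ _)
    · have hj := slowlyVarying_jumps_le hU hQc hx x.isHybridTimeDomain.zero_mem ht htraj.nonneg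
        (Nat.zero_le j)
      have hMt' : M ≤ t := by
        have h2 := (le_max_right _ _).trans hMt
        rw [sub_zero, Nat.cast_zero, sub_zero] at hj
        have h3 : (1 + η₁) * M ≤ (1 + η₁) * t := by linarith
        exact le_of_mul_le_mul_left h3 (by linarith)
      have h2 := hend hx ht hwt hθt (h1.2 hMt')
      linarith [hηκ.trans (min_le_right _ _)]

theorem isCompact_timedParameters (hQ : IsCompact Q) :
    IsCompact {z : EProd (Euc m) ℝ | z.fst ∈ Q ∧ z.snd ∈ Icc 0 N₀} := by
  convert (hQ.prod (isCompact_Icc (a := (0 : ℝ)) (b := N₀))).image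
    (WithLp.prod_continuous_toLp 2 (Euc m) ℝ) using 1
  ext z
  exact ⟨fun hz => ⟨(z.fst, z.snd), hz, rfl⟩, by rintro ⟨p, hp, rfl⟩; exact hp⟩

end Main

theorem mainTheorem9 {n m : ℕ} (U : Set (Euc n)) (Q : Set (Euc m)) (hQ : IsCompact Q)
    (J : Euc m → Euc n → ℝ)
    (hJ : ∀ q ∈ Q, ∀ u ∈ U, DifferentiableAt ℝ (J q) u)
    (hJ' : ContinuousOn (fun p : Euc m × Euc n => gradient (J p.1) p.2) (Q ×ˢ U))
    (f : Euc n → Euc n → Euc m → Set (Euc n))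
    (hf : (freeSwitching U Q f).RegularData U)
    (O : Euc m → Set (Euc n))
    (hO_sub : ∀ q ∈ Q, O q ⊆ U) (hO_ne : ∀ q ∈ Q, (O q).Nonempty)
    (hO_compact : IsCompact {x : EProd (Euc n) (Euc m) | x.snd ∈ Q ∧ x.fst ∈ O x.snd})
    (hO_stable : ∀ q ∈ Q, UGAS (frozenSystem U J f q) (O q))
    (η₁ N₀ : ℝ) (hη₁ : 0 < η₁) (hN₀ : 1 ≤ N₀) :
    (slowlyVarying U Q f η₁ N₀).KeyAssumption U (fun z => J z.fst) (fun z => O z.fst)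
      {z | z.fst ∈ Q ∧ z.snd ∈ Icc 0 N₀} := by
  have hfm := hf.regularFlowMap
  have hO := isCompact_fiberedSet hO_compact
  refine ⟨hfm.regularData_slowlyVarying hQ hf.isClosed η₁ N₀, isCompact_timedParameters hQ, ?_⟩
  rcases Q.eq_empty_or_nonempty with rfl | hne
  -- With `Q` empty, the flow and jump sets are empty and there are no solutions.
  · refine sgpas_of_practical (isCompact_timedSet hO) (fun ε hε => ⟨1, one_pos, ?_⟩)
      (fun R ε hε => ⟨1, one_pos, ?_⟩)
    all_goals
      refine .of_forall fun η x hx => ?_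
      rcases hx.init with h | h <;> exact absurd h.2.1 (notMem_empty _)
  · exact sgpas_slowlyVarying (hfm.regularInclusion (hf.isClosed hne) hQ hJ')
      (frozenStable_of_ugas hO_ne hO_stable) hO hne hη₁ hN₀
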